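/- Let $M$ be a smooth manifold (Hausdorff, second countable, of dimension $n$), let $\mathcal C^\infty(M)$ be its ring of smooth real functions, and let $A$ be a Weil algebra, i.e. a finite-dimensional local commutative $\mathbb R$-algebra with residue field $\mathbb R$. A \emph{regular $A$-point} of $M$ is a surjective $\mathbb R$-algebra morphism $q\colon\mathcal C^\infty(M)\to A$; a \emph{jet of type $A$} is an ideal $\mathfrak p\subset\mathcal C^\infty(M)$ with $\mathcal C^\infty(M)/\mathfrak p\simeq A$ as $\mathbb R$-algebras. Let $\check M^A$ and $\mathbb M^A$ be the sets of regular $A$-points and of jets of type $A$, and $\mathrm{Ker}\colon\check M^A\to\mathbb M^A$, $q\mapsto\ker q$. For $f\in\mathcal C^\infty(M)$ and a linear form $\omega\in A^*$, the real component $f_\omega\colon\check M^A\to\mathbb R$ is $f_\omega(q)=\omega(q(f))$. Give $\check M^A$ the smooth structure generated by the real components: its topology is the initial one, and a function is smooth when it is locally a smooth function of finitely many real components. Give $\mathbb M^A$ the quotient smooth structure under $\mathrm{Ker}$: a function $F$ on $\mathbb M^A$ is smooth when $F\circ\mathrm{Ker}$ is smooth on $\check M^A$. The tangent spaces $T_q\check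 M^A$ and $T_{\mathfrak p}\mathbb M^A$ are the real vector spaces of $\mathbb R$-valued derivations, at the given point, of the ring of smooth functions. \textbf{Theorem.} For every jet $\mathfrak p\in\mathbb M^A$, the tangent space $T_{\mathfrak p}\mathbb M^A$ is canonically isomorphic, as a real vector space, to the algebraic tangent module $$T_{\mathfrak p}M=\mathrm{Der}_{\mathbb R}(\mathcal C^\infty(M),\mathcal C^\infty(M)/\mathfrak p)\big/\mathrm{Der}_{\mathbb R}(\mathcal C^\infty(M)/\mathfrak p,\mathcal C^\infty(M)/\mathfrak p),$$ where derivations of $\mathcal C^\infty(M)/\mathfrak p$ are regarded as derivations of $\mathcal C^\infty(M)$ by composing with the quotient map. More precisely, there is a unique linear isomorphism $\Phi\colon T_{\mathfrak p}\mathbb M^A\to T_{\mathfrak p}M$ with the following property: for every $q\in\check M^A$ with $\ker q=\mathfrak p$ and induced isomorphism $\bar q\colon\mathcal C^\infty(M)/\mathfrak p\to A$, and for all $v\in T_q\check M^A$ and $D\in\mathrm{Der}_{\mathbb R}(\mathcal C^\infty(M),\mathcal C^\infty(M)/\mathfrak p)$ such that $v(f_\omega)=\omega(\bar q(Df))$ for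 all $f\in\mathcal C^\infty(M)$ and $\omega\in A^*$, one has $\Phi(\mathrm{Ker}_*v)=[D]$, where $\mathrm{Ker}_*v$ is the derivation $F\mapsto v(F\circ\mathrm{Ker})$. -/

import Mathlib

open scoped Manifold ContDiff Topology

noncomputable section

/-- A Weil algebra: a finite dimensional local `ℝ`-algebra which is rational, i.e. whose residue
field is `ℝ`. -/
class IsWeilAlgebra (A : Type*) [CommRing A] [Algebra ℝ A] : Prop extends
    IsLocalRing A, Module.Finite ℝ A where
  rational : Function.Surjective (algebraMap ℝ (IsLocalRing.ResidueField A))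

/-- The ring `C^∞(M)` of smooth real functions on an `n`-dimensional manifold `M`. -/
abbrev SmoothRing (n : ℕ) (M : Type*) [TopologicalSpace M]
    [ChartedSpace (EuclideanSpace ℝ (Fin n)) M] : Type _ :=
  C^∞⟮𝓡 n, M; ℝ⟯

section PointDerivations

/-- The tangent space at `x` of a space `X` whose ring of smooth real functions is `S`:
the `ℝ`-valued derivations of `S` at the point `x`. -/
def tangentSpaceAt {X : Type*} (S : Subalgebra ℝ (X → ℝ)) (x : X) : Submodule ℝ (S →ₗ[ℝ] ℝ) where
  carrier := {v | ∀ F G : S, v (F * G) = F.1 x * v G + G.1 x * v F}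
  add_mem' := by
    intro v w hv hw F G
    simp only [LinearMap.add_apply, hv F G, hw F G]
    ring
  zero_mem' := by
    intro F G
    simp
  smul_mem' := by
    intro c v hv F G
    simp only [LinearMap.smul_apply, smul_eq_mul, hv F G]
    ring

end PointDerivations

section RegularPoints

variable (n : ℕ) (M : Type*) [TopologicalSpace M] [ChartedSpace (EuclideanSpace ℝ (Fin n)) M]
  (A : Type*) [CommRing A] [Algebra ℝ A]

/-- The set of regular `A`-points of `M`: surjective `ℝ`-algebra morphisms `C^∞(M) → A`. -/
def RegularPoint : Type _ :=
  {q : SmoothRing n M →ₐ[ℝ] A // Function.Surjective q}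

variable {n M A}

/-- The real component `f_w : q ↦ w (q f)` of `f ∈ C^∞(M)` along a linear functional `w` on `A`.
(The components with respect to a basis of `A` are those along the dual basis.) -/
def realComponent (f : SmoothRing n M) (w : Module.Dual ℝ A) (q : RegularPoint n M A) : ℝ :=
  w (q.1 f)

/-- The coarsest topology for which all real components are continuous. -/
instance : TopologicalSpace (RegularPoint n M A) :=
  ⨅ (f : SmoothRing n M) (w : Module.Dual ℝ A),
    TopologicalSpace.induced (realComponent f w) inferInstance

/-- A real function is smooth at `q` if near `q` it is a smooth function of finitely many
real components. -/
def SmoothAtRegularPoint (F : RegularPoint n M A → ℝ) (q : RegularPoint n M A) : Prop :=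
  ∃ (k : ℕ) (f : Fin k → SmoothRing n M) (w : Fin k → Module.Dual ℝ A) (h : (Fin k → ℝ) → ℝ),
    ContDiff ℝ ∞ h ∧ ∀ᶠ q' in 𝓝 q, F q' = h (fun i => realComponent (f i) (w i) q')

theorem SmoothAtRegularPoint.const (c : ℝ) (q : RegularPoint n M A) :
    SmoothAtRegularPoint (fun _ => c) q :=
  ⟨0, Fin.elim0, Fin.elim0, fun _ => c, contDiff_const, Filter.Eventually.of_forall fun _ => rfl⟩

theorem SmoothAtRegularPoint.comp₂ {F G : RegularPoint n M A → ℝ} {q : RegularPoint n M A}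
    (hF : SmoothAtRegularPoint F q) (hG : SmoothAtRegularPoint G q) {b : ℝ × ℝ → ℝ}
    (hb : ContDiff ℝ ∞ b) : SmoothAtRegularPoint (fun q' => b (F q', G q')) q := by
  obtain ⟨k, f, w, h, hh, hE⟩ := hF
  obtain ⟨l, g, u, h', hh', hE'⟩ := hG
  refine ⟨k + l, Fin.append f g, Fin.append w u,
    fun x => b (h (fun i => x (Fin.castAdd l i)), h' (fun j => x (Fin.natAdd k j))), ?_, ?_⟩
  · refine hb.comp (ContDiff.prodMk (hh.comp ?_) (hh'.comp ?_))
    · exact contDiff_pi.2 fun i => contDiff_apply ℝ ℝ _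
    · exact contDiff_pi.2 fun i => contDiff_apply ℝ ℝ _
  · filter_upwards [hE, hE'] with q' h1 h2
    simp only [h1, h2, Fin.append_left, Fin.append_right]

variable (n M A)

/-- The ring of smooth functions on the manifold of regular `A`-points of `M`, whose smooth
structure is the one generated by the real components of the functions on `M`. -/
def smoothOnRegularPoints : Subalgebra ℝ (RegularPoint n M A → ℝ) where
  carrier := {F | ∀ q, SmoothAtRegularPoint F q}
  mul_mem' := fun hF hG q => (hF q).comp₂ (hG q) (b := fun p => p.1 * p.2)
    (contDiff_fst.mul contDiff_snd)
  add_mem' := fun hF hG q => (hF q).comp₂ (hG q) (b := fun p => p.1 + p.2)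
    (contDiff_fst.add contDiff_snd)
  algebraMap_mem' := fun c q => SmoothAtRegularPoint.const c q

variable {n M A}

theorem realComponent_smooth (f : SmoothRing n M) (w : Module.Dual ℝ A) :
    realComponent f w ∈ smoothOnRegularPoints n M A := fun _ =>
  ⟨1, fun _ => f, fun _ => w, fun x => x 0, contDiff_apply ℝ ℝ _,
    Filter.Eventually.of_forall fun _ => rfl⟩

end RegularPoints

section Jets

variable (n : ℕ) (M : Type*) [TopologicalSpace M] [ChartedSpace (EuclideanSpace ℝ (Fin n)) M]
  (A : Type*) [CommRing A] [Algebra ℝ A]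

/-- The set of jets of `M` of type `A`: the ideals `𝔭` of `C^∞(M)` with `C^∞(M)/𝔭 ≃ A`. -/
def JetOfType : Type _ :=
  {𝔭 : Ideal (SmoothRing n M) // Nonempty ((SmoothRing n M ⧸ 𝔭) ≃ₐ[ℝ] A)}

variable {n M A}

/-- The canonical projection from regular `A`-points to jets of type `A`, `q ↦ Ker q`. -/
def RegularPoint.jet (q : RegularPoint n M A) : JetOfType n M A :=
  ⟨RingHom.ker q.1, ⟨Ideal.quotientKerAlgEquivOfSurjective q.2⟩⟩

variable (n M A)

/-- The ring of smooth functions on the manifold of jets of type `A`, whose smooth structure is the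
quotient structure for the principal bundle `Ker` with group `Aut A`: a function of the jet `𝔭` is
smooth when its pullback by `Ker` is a smooth function on the manifold of regular `A`-points. -/
def smoothOnJets : Subalgebra ℝ (JetOfType n M A → ℝ) where
  carrier := {F | (fun q : RegularPoint n M A => F q.jet) ∈ smoothOnRegularPoints n M A}
  mul_mem' := fun hF hG => (smoothOnRegularPoints n M A).mul_mem hF hG
  add_mem' := fun hF hG => (smoothOnRegularPoints n M A).add_mem hF hG
  algebraMap_mem' := fun c => (smoothOnRegularPoints n M A).algebraMap_mem c

variable {n M A}

/-- The pullback of smooth functions by the projection `Ker`. -/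
def kerPullback : smoothOnJets n M A →ₗ[ℝ] smoothOnRegularPoints n M A where
  toFun F := ⟨fun q => F.1 q.jet, F.2⟩
  map_add' _ _ := rfl
  map_smul' _ _ := rfl

/-- The tangent map of the projection `Ker` at a regular `A`-point `q` with `Ker q = 𝔭`. -/
def kerTangentMap (q : RegularPoint n M A) (𝔭 : JetOfType n M A) (hq : q.jet = 𝔭) :
    tangentSpaceAt (smoothOnRegularPoints n M A) q →ₗ[ℝ] tangentSpaceAt (smoothOnJets n M A) 𝔭 where
  toFun v := ⟨v.1 ∘ₗ kerPullback, by
    subst hq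
    exact fun F G => v.2 (kerPullback F) (kerPullback G)⟩
  map_add' _ _ := rfl
  map_smul' _ _ := rfl

/-- The algebraic tangent module at an ideal `𝔭`:
`T_𝔭 M = Der(C^∞(M), C^∞(M)/𝔭) / Der(C^∞(M)/𝔭, C^∞(M)/𝔭)`, where the derivations of `C^∞(M)/𝔭`
are seen as derivations of `C^∞(M)` by composition with the quotient map. -/
abbrev TangentModule (𝔭 : Ideal (SmoothRing n M)) : Type _ :=
  Derivation ℝ (SmoothRing n M) (SmoothRing n M ⧸ 𝔭) ⧸
    LinearMap.range (Derivation.compAlgebraMapL ℝ (SmoothRing n M) (SmoothRing n M ⧸ 𝔭)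
      (SmoothRing n M ⧸ 𝔭))

/-- The morphism `C^∞(M)/𝔭 → A` induced by a regular `A`-point `q` with `Ker q = 𝔭`. -/
def RegularPoint.quotientMap (q : RegularPoint n M A) (𝔭 : JetOfType n M A) (hq : q.jet = 𝔭) :
    (SmoothRing n M ⧸ 𝔭.1) →ₐ[ℝ] A :=
  Ideal.Quotient.liftₐ 𝔭.1 q.1 (by subst hq; exact fun _ ha => ha)

/-- A tangent vector `v` at `q` to the manifold of regular `A`-points corresponds to a derivation
`D : C^∞(M) → C^∞(M)/𝔭 ≃ A` (`𝔭 = Ker q`, isomorphism induced by `q`) when `v (f_w) = (D f)_w`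
for all `f ∈ C^∞(M)` and all components `w`. -/
def Corresponds (q : RegularPoint n M A) (𝔭 : JetOfType n M A) (hq : q.jet = 𝔭)
    (v : tangentSpaceAt (smoothOnRegularPoints n M A) q)
    (D : Derivation ℝ (SmoothRing n M) (SmoothRing n M ⧸ 𝔭.1)) : Prop :=
  ∀ (f : SmoothRing n M) (w : Module.Dual ℝ A),
    v.1 ⟨realComponent f w, realComponent_smooth f w⟩ = w (q.quotientMap 𝔭 hq (D f))

end Jets

end

/-!
The projection `Ker` is the quotient by the automorphisms of `A`, and the tangent space of the base
of such a quotient is the tangent space upstairs modulo the vertical vectors. A tangent vector at a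
regular point `q` amounts to a derivation `C^∞(M) → A` over `q`, and the vertical ones are those of
the form `δ ∘ q` with `δ` a derivation of `A`. Both facts, and the existence of enough smooth
functions of jets, have to be derived from the definition of tangent vectors as point derivations.

* Tangent vectors at a regular point only depend on germs and satisfy the chain rule, so that they
  are determined by their values on the real components (`tangentSpaceAt.ext_realComponent`). Every
  derivation `C^∞(M) → A` over `q` occurs (`exists_tangent_of_derivation`): in a chart at the base
  point of `q` it is realized by a vector field, and the vector field moves `q` along a curve of
  regular points. For the smoothness of that curve, Hadamard's lemma is iterated, the maximal ideal
  of `A` being nilpotent (`contDiff_apply_family`).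

* Vectors of the form `δ ∘ q` are velocities of the curves `exp (t δ) ∘ q`, and kill the functions
  which come from jets (`tangentSpaceAt.apply_eq_zero_of_vertical`).

* Smooth functions of jets are constructed with a slice for the action of the automorphisms. On
  finitely many functions whose values span `A`, a regular point is a surjective linear map
  `ℝ^L → A` (`exists_spanning_functions`). The automorphisms of `A` act on these surjections properly and
  freely; a slice comes from the inverse function theorem, applied to the change of variables in
  the product of `A`, whose derivative at the identity has as its kernel the derivations
  (`exists_slice`). This yields an `OrbitNormalization`: endomorphisms `θ q` of `A`, smooth in `q`,
  with `θ (τ ∘ q) ∘ τ = θ q`, which are automorphisms near `q₀` and the identity at `q₀`. Thus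
  `q ↦ w (θ q (q f))` is a smooth function of jets, the component `S(f, w)`.

A tangent vector `u` at the jet `𝔭` of `q₀` gives the derivation `f ↦ u (S(f, ·))` of `C^∞(M)` in
`A = C^∞(M)/𝔭`, and `Φ u` is its class. For `u = Ker_* v`, Leibniz' rule for `θ q (q f)` shows that
this derivation agrees on `𝔭`, where `q f = 0`, with the derivation of `v`; hence the
characteristic property (`OrbitNormalization.der_kerTangentMap`). Conversely, the components
generate the smooth functions of jets near `𝔭`, so that each `u` is the projection of a vector at
`q₀` with the same derivation (`OrbitNormalization.kerTangentMap_eq`). Surjectivity and uniqueness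
follow, and injectivity does because vertical vectors have projection zero.
-/

noncomputable section

/-! ### Hadamard's lemma -/

section Hadamard

open MeasureTheory intervalIntegral

theorem hasFDerivAt_intervalIntegral_of_contDiff {Z G : Type} [NormedAddCommGroup Z]
    [NormedSpace ℝ Z] [FiniteDimensional ℝ Z] [NormedAddCommGroup G] [NormedSpace ℝ G]
    {F : Z × ℝ → G} (hF : ContDiff ℝ 1 F) (z : Z) :
    HasFDerivAt (fun z => ∫ s in (0 : ℝ)..1, F (z, s))
      (∫ s in (0 : ℝ)..1, (fderiv ℝ F (z, s)).comp (ContinuousLinearMap.inl ℝ Z ℝ)) z := by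
  have : ProperSpace Z := FiniteDimensional.proper ℝ Z
  have hc : Continuous fun p : Z × ℝ => (fderiv ℝ F p).comp (ContinuousLinearMap.inl ℝ Z ℝ) :=
    (hF.continuous_fderiv one_ne_zero).clm_comp continuous_const
  obtain ⟨C, hC⟩ := ((isCompact_closedBall z 1).prod (isCompact_Icc (a := (0 : ℝ))
    (b := 1))).exists_bound_of_continuousOn hc.continuousOn
  refine hasFDerivAt_integral_of_dominated_of_fderiv_le (bound := fun _ => C)
    (F' := fun z s => (fderiv ℝ F (z, s)).comp (ContinuousLinearMap.inl ℝ Z ℝ))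
    (Metric.closedBall_mem_nhds z one_pos) ?_ ?_ ?_ ?_ ?_ ?_
  · exact Filter.Eventually.of_forall fun z' =>
      (hF.continuous.comp (Continuous.prodMk_right z')).aestronglyMeasurable
  · exact (hF.continuous.comp (Continuous.prodMk_right z)).intervalIntegrable _ _
  · exact (hc.comp (Continuous.prodMk_right z)).aestronglyMeasurable
  · refine Filter.Eventually.of_forall fun t ht x hx => hC (x, t) ⟨hx, ?_⟩
    rw [Set.uIoc_of_le zero_le_one] at ht
    exact ⟨ht.1.le, ht.2⟩
  · exact intervalIntegrable_const
  · refine Filter.Eventually.of_forall fun t _ x _ => ?_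
    exact ((hF.differentiable one_ne_zero (x, t)).hasFDerivAt).comp x (hasFDerivAt_prodMk_left x t)

theorem ContDiff.intervalIntegral_nat {Z : Type} [NormedAddCommGroup Z] [NormedSpace ℝ Z]
    [FiniteDimensional ℝ Z] (n : ℕ) : ∀ {G : Type} [NormedAddCommGroup G] [NormedSpace ℝ G]
    {F : Z × ℝ → G}, ContDiff ℝ ∞ F → ContDiff ℝ n fun z => ∫ s in (0 : ℝ)..1, F (z, s) := by
  induction n with
  | zero =>
    intro G _ _ F hF
    refine contDiff_zero.2 ?_
    exact continuous_parametric_intervalIntegral_of_continuous' (f := fun z s => F (z, s))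
      (by exact hF.continuous) 0 1
  | succ n ih =>
    intro G _ _ F hF
    refine contDiff_succ_iff_hasFDerivAt.2 ⟨_, ih (F := fun p => (fderiv ℝ F p).comp
      (ContinuousLinearMap.inl ℝ Z ℝ)) ?_, fun z =>
      hasFDerivAt_intervalIntegral_of_contDiff (hF.of_le (by exact_mod_cast le_top)) z⟩
    exact (hF.fderiv_right (m := ∞) (by exact_mod_cast le_top)).clm_comp contDiff_const

/-- The integral over `[0, 1]` of a smooth function depending smoothly on a parameter is a smooth
function of the parameter. -/
theorem ContDiff.intervalIntegral_zero_one {Z G : Type} [NormedAddCommGroup Z] [NormedSpace ℝ Z]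
    [FiniteDimensional ℝ Z] [NormedAddCommGroup G] [NormedSpace ℝ G]
    {F : Z × ℝ → G} (hF : ContDiff ℝ ∞ F) : ContDiff ℝ ∞ fun z => ∫ s in (0 : ℝ)..1, F (z, s) :=
  contDiff_infty.2 fun n => ContDiff.intervalIntegral_nat n hF

/-- Hadamard's lemma with parameters: a smooth function `F (p, y)` is
`F (p, y₀) + L (p, y) (y - y₀)` for a smooth family `L` of linear forms, whose value at `(p, y₀)` is
the partial derivative of `F`. -/
theorem hadamard_parametric {P E : Type} [NormedAddCommGroup P] [NormedSpace ℝ P]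
    [FiniteDimensional ℝ P] [NormedAddCommGroup E] [NormedSpace ℝ E] [FiniteDimensional ℝ E]
    {F : P × E → ℝ} (hF : ContDiff ℝ ∞ F) (y₀ : E) :
    ∃ L : P × E → E → ℝ, (∀ e, ContDiff ℝ ∞ fun z => L z e) ∧ (∀ z, IsLinearMap ℝ (L z)) ∧
      (∀ p y, F (p, y) = F (p, y₀) + L (p, y) (y - y₀)) ∧
      ∀ p e, L (p, y₀) e = fderiv ℝ F (p, y₀) (0, e) := by
  have hF1 : ContDiff ℝ ∞ (fderiv ℝ F) := hF.fderiv_right (m := ∞) (by exact_mod_cast le_top)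
  have hpath : ContDiff ℝ ∞ fun w : (P × E) × ℝ => (w.1.1, y₀ + w.2 • (w.1.2 - y₀)) := by
    fun_prop
  have hint : ∀ e, ContDiff ℝ ∞ fun w : (P × E) × ℝ =>
      fderiv ℝ F (w.1.1, y₀ + w.2 • (w.1.2 - y₀)) (0, e) := fun e =>
    (hF1.comp hpath).clm_apply contDiff_const
  have hii : ∀ (z : P × E) (e : E), IntervalIntegrable (fun s : ℝ =>
      fderiv ℝ F (z.1, y₀ + s • (z.2 - y₀)) (0, e)) volume 0 1 := fun z e =>
    ((hint e).continuous.comp (Continuous.prodMk_right z)).intervalIntegrable _ _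
  -- the fundamental theorem of calculus on the segment from `y₀` to `y`
  refine ⟨fun (z : P × E) e => ∫ s in (0 : ℝ)..1, fderiv ℝ F (z.1, y₀ + s • (z.2 - y₀)) (0, e),
    ?_, ?_, ?_, ?_⟩
  · exact fun e => ContDiff.intervalIntegral_zero_one (hint e)
  · intro z
    constructor
    · intro e e'
      rw [← intervalIntegral.integral_add (hii z e) (hii z e')]
      refine intervalIntegral.integral_congr fun s _ => ?_
      rw [← map_add]; simp
    · intro c e
      rw [← intervalIntegral.integral_smul]
      refine intervalIntegral.integral_congr fun s _ => ?_
      rw [← map_smul]; simp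
  · intro p y
    have hd : ∀ s ∈ Set.uIcc (0 : ℝ) 1, HasDerivAt (fun s : ℝ => F (p, y₀ + s • (y - y₀)))
        (fderiv ℝ F (p, y₀ + s • (y - y₀)) (0, y - y₀)) s := by
      intro s _
      have h1 : HasDerivAt (fun s : ℝ => (p, y₀ + s • (y - y₀))) ((0 : P), y - y₀) s := by
        refine (hasDerivAt_const s p).prodMk ?_
        simpa using ((hasDerivAt_id s).smul_const (y - y₀)).const_add y₀
      exact ((hF.differentiable (by simp)) _).hasFDerivAt.comp_hasDerivAt s h1
    have := intervalIntegral.integral_eq_sub_of_hasDerivAt hd (hii (p, y) (y - y₀))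
    simp only [one_smul, zero_smul, add_zero, add_sub_cancel] at this
    simp only [this]; ring
  · intro p e
    simp

end Hadamard

/-! ### A slice for the action of the automorphism group of an algebra -/

section Slice

variable {V : Type*} [NormedAddCommGroup V] [NormedSpace ℝ V] (B : V →L[ℝ] V →L[ℝ] V)

/-- The linear automorphisms of `V` which preserve the product `B`. -/
def IsBilinAut (h : V →L[ℝ] V) : Prop :=
  IsUnit h ∧ ∀ x y, h (B x y) = B (h x) (h y)

/-- The derivations of the (not necessarily associative) algebra `(V, B)`. -/
def bilinDer : Submodule ℝ (V →L[ℝ] V) where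
  carrier := {δ | ∀ x y, δ (B x y) = B (δ x) y + B x (δ y)}
  add_mem' := by
    intro a b ha hb x y
    simp only [add_apply, ha x y, hb x y, map_add]
    abel
  zero_mem' := by
    intro x y
    simp
  smul_mem' := by
    intro c a ha x y
    simp [ha x y]

/-- The product `Q⁻¹ B(Q x, Q y)` obtained from `B` by the change of variables `Q`
(with the junk value `0` when `Q` is not invertible). -/
def bilinTransport (Q : V →L[ℝ] V) : V →L[ℝ] V →L[ℝ] V :=
  (ContinuousLinearMap.compL ℝ V V V (Ring.inverse Q)).comp (((B.comp Q).flip.comp Q).flip)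

variable {B}

theorem bilinTransport_apply (Q : V →L[ℝ] V) (x y : V) :
    bilinTransport B Q x y = Ring.inverse Q (B (Q x) (Q y)) := rfl

theorem IsBilinAut.mul {h k : V →L[ℝ] V} (hh : IsBilinAut B h) (hk : IsBilinAut B k) :
    IsBilinAut B (h * k) :=
  ⟨hh.1.mul hk.1, fun x y => by simp [hk.2, hh.2]⟩

theorem IsUnit.ringInverse_apply_apply {h : V →L[ℝ] V} (hh : IsUnit h) (x : V) :
    Ring.inverse h (h x) = x :=
  congrArg (fun f : V →L[ℝ] V => f x) (Ring.inverse_mul_cancel _ hh)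

theorem IsUnit.apply_ringInverse_apply {h : V →L[ℝ] V} (hh : IsUnit h) (x : V) :
    h (Ring.inverse h x) = x :=
  congrArg (fun f : V →L[ℝ] V => f x) (Ring.mul_inverse_cancel _ hh)

theorem IsBilinAut.inverse {h : V →L[ℝ] V} (hh : IsBilinAut B h) :
    IsBilinAut B (Ring.inverse h) := by
  refine ⟨hh.1.ringInverse, fun x y => ?_⟩
  have h1 := hh.2 (Ring.inverse h x) (Ring.inverse h y)
  rw [hh.1.apply_ringInverse_apply, hh.1.apply_ringInverse_apply] at h1
  rw [← h1, hh.1.ringInverse_apply_apply]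

/-- The transported product is invariant under the automorphisms of `(V, B)`. -/
theorem bilinTransport_mul_left {k : V →L[ℝ] V} (hk : IsBilinAut B k) {Q : V →L[ℝ] V}
    (hQ : IsUnit Q) : bilinTransport B (k * Q) = bilinTransport B Q := by
  ext x y
  have hi : Ring.inverse (k * Q) = Ring.inverse Q * Ring.inverse k := by
    obtain ⟨k, rfl⟩ := hk.1
    obtain ⟨Q, rfl⟩ := hQ
    rw [← Units.val_mul, Ring.inverse_unit, Ring.inverse_unit, Ring.inverse_unit]
    simp
  have h1 := hk.1.ringInverse_apply_apply (B (Q x) (Q y))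
  rw [hk.2] at h1
  rw [bilinTransport_apply, hi]
  change Ring.inverse Q (Ring.inverse k (B (k (Q x)) (k (Q y)))) = _
  rw [h1, bilinTransport_apply]

variable [CompleteSpace V]

/-- The exponential of a derivation is an automorphism. -/
theorem isBilinAut_exp {δ : V →L[ℝ] V} (hδ : δ ∈ bilinDer B) :
    IsBilinAut B (NormedSpace.exp δ) := by
  let _ : NormedAlgebra ℚ (V →L[ℝ] V) := NormedAlgebra.restrictScalars ℚ ℝ (V →L[ℝ] V)
  have hmul : NormedSpace.exp δ * NormedSpace.exp (-δ) = 1 := by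
    rw [← NormedSpace.exp_add_of_commute (Commute.neg_right (Commute.refl δ)), add_neg_cancel,
      NormedSpace.exp_zero]
  refine ⟨NormedSpace.isUnit_exp δ, fun x y => ?_⟩
  have he : ∀ t : ℝ, HasDerivAt (fun t : ℝ => NormedSpace.exp (t • δ))
      (δ * NormedSpace.exp (t • δ)) t := fun t => hasDerivAt_exp_smul_const' δ t
  have he' : ∀ t : ℝ, HasDerivAt (fun t : ℝ => NormedSpace.exp (t • -δ))
      (NormedSpace.exp (t • -δ) * -δ) t := fun t => hasDerivAt_exp_smul_const (-δ) t
  -- the curve `exp(-tδ) B(exp(tδ) x, exp(tδ) y)` is constant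
  have hd : ∀ t : ℝ, HasDerivAt (fun t : ℝ => NormedSpace.exp (t • -δ)
      (B (NormedSpace.exp (t • δ) x) (NormedSpace.exp (t • δ) y))) 0 t := by
    intro t
    have hx := (he t).clm_apply (hasDerivAt_const t x)
    have hy := (he t).clm_apply (hasDerivAt_const t y)
    have h1 := (he' t).clm_apply ((((hasDerivAt_const t B).clm_apply hx)).clm_apply hy)
    convert! h1 using 1
    simp [hδ _ _]
  have hconst := is_const_of_deriv_eq_zero (fun t => (hd t).differentiableAt)
    (fun t => (hd t).deriv) 1 0
  simp only [one_smul, zero_smul, NormedSpace.exp_zero, one_apply_eq_self] at hconst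
  rw [← hconst]
  exact congrArg (fun f : V →L[ℝ] V => f _) hmul

theorem contDiffAt_bilinTransport {n : WithTop ℕ∞} {Q : V →L[ℝ] V} (hQ : IsUnit Q) :
    ContDiffAt ℝ n (bilinTransport B) Q := by
  obtain ⟨u, rfl⟩ := hQ
  have h1 : ContDiffAt ℝ n (Ring.inverse : (V →L[ℝ] V) → _) (u : V →L[ℝ] V) :=
    contDiffAt_ringInverse ℝ u
  have h2 : ContDiffAt ℝ n (fun Q : V →L[ℝ] V => (B.comp Q).flip) (u : V →L[ℝ] V) :=
    (ContinuousLinearMap.flipₗᵢ ℝ V V V).contDiff.contDiffAt.comp _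
      (contDiffAt_const.clm_comp contDiffAt_id)
  have h3 : ContDiffAt ℝ n (fun Q : V →L[ℝ] V => ((B.comp Q).flip.comp Q).flip)
      (u : V →L[ℝ] V) :=
    (ContinuousLinearMap.flipₗᵢ ℝ V V V).contDiff.contDiffAt.comp _
      (h2.clm_comp contDiffAt_id)
  exact ((ContinuousLinearMap.compL ℝ V V V).contDiff.contDiffAt.comp _ h1).clm_comp h3

/-- The derivative of the change of variables at the identity: its kernel consists of the
derivations. -/
theorem fderiv_bilinTransport_one (E : V →L[ℝ] V) (x y : V) :
    fderiv ℝ (bilinTransport B) 1 E x y = B (E x) y + B x (E y) - E (B x y) := by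
  have hd : HasFDerivAt (bilinTransport B) (fderiv ℝ (bilinTransport B) 1) 1 :=
    ((contDiffAt_bilinTransport (n := 1) isUnit_one).differentiableAt one_ne_zero).hasFDerivAt
  have hl : HasDerivAt (fun t : ℝ => (1 : V →L[ℝ] V) + t • E) E 0 := by
    simpa using ((hasDerivAt_id (0 : ℝ)).smul_const E).const_add (1 : V →L[ℝ] V)
  have hl0 : (1 : V →L[ℝ] V) + (0 : ℝ) • E = 1 := by simp
  have ho : HasDerivAt (fun t : ℝ => bilinTransport B (1 + t • E))
      (fderiv ℝ (bilinTransport B) 1 E) 0 :=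
    HasFDerivAt.comp_hasDerivAt (l := bilinTransport B) (f := fun t : ℝ => (1 : V →L[ℝ] V) + t • E)
      (0 : ℝ) (by rwa [hl0]) hl
  have h1 := hl.clm_apply ((ho.clm_apply (hasDerivAt_const 0 x)).clm_apply (hasDerivAt_const 0 y))
  have h2 := (((hasDerivAt_const (0 : ℝ) B).clm_apply
    (hl.clm_apply (hasDerivAt_const 0 x))).clm_apply (hl.clm_apply (hasDerivAt_const 0 y)))
  have hone : ∀ᶠ Q : V →L[ℝ] V in 𝓝 1, IsUnit Q := Units.nhds (1 : (V →L[ℝ] V)ˣ)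
  have hu : ∀ᶠ t : ℝ in 𝓝 0, IsUnit ((1 : V →L[ℝ] V) + t • E) :=
    hl.continuousAt.eventually (by simpa only [hl0] using hone)
  -- both sides of `Q (Q⁻¹ B(Q x, Q y)) = B(Q x, Q y)` are differentiated along `Q = 1 + t E`
  have h3 := h2.congr_of_eventuallyEq (f₁ := fun t : ℝ => ((1 : V →L[ℝ] V) + t • E)
    (bilinTransport B (1 + t • E) x y)) (by
      filter_upwards [hu] with t ht
      rw [bilinTransport_apply, ht.apply_ringInverse_apply])
  have h4 := h1.unique h3
  simp [bilinTransport_apply] at h4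
  rw [eq_sub_iff_add_eq, ← h4]
  abel

end Slice

section Slice

variable {V : Type*} [NormedAddCommGroup V] [NormedSpace ℝ V] [FiniteDimensional ℝ V]

theorem Submodule.exists_continuousLinearMap_range_eq {X : Type*} [NormedAddCommGroup X]
    [NormedSpace ℝ X] [FiniteDimensional ℝ X] (S : Submodule ℝ X) :
    ∃ (m : ℕ) (j : (Fin m → ℝ) →L[ℝ] X), Function.Injective j ∧ ∀ x, x ∈ S ↔ ∃ c, j c = x := by
  let e := (Module.finBasis ℝ S).equivFun.symm
  refine ⟨Module.finrank ℝ S, LinearMap.toContinuousLinearMap (S.subtype ∘ₗ e.toLinearMap),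
    Subtype.val_injective.comp e.injective, fun x => ⟨fun hx => ⟨e.symm ⟨x, hx⟩, by simp⟩, ?_⟩⟩
  rintro ⟨c, rfl⟩
  exact (e c).2

/-- A smooth map with injective derivative at a point has a smooth local left inverse. -/
theorem ContDiffAt.exists_local_leftInverse {X Y : Type*} [NormedAddCommGroup X] [NormedSpace ℝ X]
    [FiniteDimensional ℝ X] [NormedAddCommGroup Y] [NormedSpace ℝ Y] [FiniteDimensional ℝ Y]
    {f : X → Y} {x : X} {n : WithTop ℕ∞} (hn : n ≠ 0) (hf : ContDiffAt ℝ n f x)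
    (hinj : Function.Injective (fderiv ℝ f x)) :
    ∃ ψ : Y → X, ContDiffAt ℝ n ψ (f x) ∧ ∀ᶠ x' in 𝓝 x, ψ (f x') = x' := by
  have : CompleteSpace X := FiniteDimensional.complete ℝ X
  obtain ⟨l, hl⟩ := LinearMap.exists_leftInverse_of_injective (fderiv ℝ f x).toLinearMap
    (LinearMap.ker_eq_bot.2 hinj)
  let lc : Y →L[ℝ] X := LinearMap.toContinuousLinearMap l
  have hg : ContDiffAt ℝ n (fun x => lc (f x)) x := lc.contDiff.contDiffAt.comp x hf
  have hg' : HasFDerivAt (fun x => lc (f x))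
      ((ContinuousLinearEquiv.refl ℝ X : X ≃L[ℝ] X) : X →L[ℝ] X) x := by
    have h1 := lc.hasFDerivAt.comp x (hf.differentiableAt hn).hasFDerivAt
    convert! h1 using 1
    ext e
    exact (congrArg (fun f : X →ₗ[ℝ] X => f e) hl).symm
  refine ⟨fun y => hg.localInverse hg' hn (lc y),
    (hg.to_localInverse hg' hn).comp (f x) lc.contDiff.contDiffAt, ?_⟩
  exact (hg.hasStrictFDerivAt' hg' hn).eventually_left_inverse

/-- If `i` and `j` together span `R`, then the products `exp (i a) * (1 + j b)` with small `a` and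
`b` fill a neighbourhood of `1`. -/
theorem map_nhds_exp_mul_one_add {X₁ X₂ R : Type*} [NormedAddCommGroup X₁] [NormedSpace ℝ X₁]
    [CompleteSpace X₁] [NormedAddCommGroup X₂] [NormedSpace ℝ X₂] [CompleteSpace X₂]
    [NormedRing R] [NormedAlgebra ℝ R] [CompleteSpace R] (i : X₁ →L[ℝ] R) (j : X₂ →L[ℝ] R)
    (h : (i.coprod j).range = ⊤) :
    Filter.map (fun p : X₁ × X₂ => NormedSpace.exp (i p.1) * (1 + j p.2)) (𝓝 0) = 𝓝 1 := by
  have h1 : HasStrictFDerivAt (fun p : X₁ × X₂ => NormedSpace.exp (i p.1))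
      ((1 : R →L[ℝ] R).comp (i.comp (ContinuousLinearMap.fst ℝ X₁ X₂))) 0 :=
    HasStrictFDerivAt.comp (g := NormedSpace.exp) (0 : X₁ × X₂)
      (by simpa using hasStrictFDerivAt_exp_zero)
      (i.comp (ContinuousLinearMap.fst ℝ X₁ X₂)).hasStrictFDerivAt
  have h2 : HasStrictFDerivAt (fun p : X₁ × X₂ => 1 + j p.2)
      (j.comp (ContinuousLinearMap.snd ℝ X₁ X₂)) 0 :=
    (j.comp (ContinuousLinearMap.snd ℝ X₁ X₂)).hasStrictFDerivAt.const_add _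
  have h3 : HasStrictFDerivAt (fun p : X₁ × X₂ => NormedSpace.exp (i p.1) * (1 + j p.2))
      (i.coprod j) 0 := by
    convert! h1.mul' h2 using 1
    ext p <;> simp
  simpa using h3.map_nhds_eq_of_surj h

/-- Near the identity, the linear endomorphisms of `V` can be moved by automorphisms of `(V, B)` to
a complement of the derivations, smoothly and canonically: `Q ↦ η Q` is smooth near `1`, takes
values in the automorphisms, and `η Q * Q` only depends on the orbit of `Q`. The element `η Q * Q =
1 + E`, with `E` in a complement of the derivations, is recovered from the product `bilinTransport
B Q`, since `E ↦ bilinTransport B (1 + E)` is an immersion at `0`. -/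
theorem exists_local_bilinAut_correction (B : V →L[ℝ] V →L[ℝ] V) :
    ∃ η : (V →L[ℝ] V) → (V →L[ℝ] V), η 1 = 1 ∧
      (∀ k Q, IsBilinAut B k → IsUnit Q → η (k * Q) * k = η Q) ∧
      ∀ᶠ Q in 𝓝 (1 : V →L[ℝ] V), IsUnit Q ∧ IsBilinAut B (η Q) ∧ ContDiffAt ℝ ∞ η Q := by
  have : CompleteSpace V := FiniteDimensional.complete ℝ V
  obtain ⟨C, hC⟩ := Submodule.exists_isCompl (bilinDer B)
  obtain ⟨m, j, hj, hjC⟩ := C.exists_continuousLinearMap_range_eq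
  obtain ⟨d, i, -, hiD⟩ := (bilinDer B).exists_continuousLinearMap_range_eq
  have hone : ∀ᶠ Q : V →L[ℝ] V in 𝓝 1, IsUnit Q := Units.nhds (1 : (V →L[ℝ] V)ˣ)
  have hbt : ContDiffAt ℝ ω (bilinTransport B) (1 + j 0) :=
    contDiffAt_bilinTransport (by simp)
  have hj1 : HasFDerivAt (fun E => 1 + j E) j 0 := j.hasFDerivAt.const_add _
  have hT : ContDiffAt ℝ ω (fun E => bilinTransport B (1 + j E)) 0 :=
    ContDiffAt.comp (f := fun E => 1 + j E) (0 : Fin m → ℝ) hbt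
      (contDiffAt_const.add j.contDiff.contDiffAt)
  have hT' : HasFDerivAt (fun E => bilinTransport B (1 + j E))
      ((fderiv ℝ (bilinTransport B) (1 + j 0)).comp j) 0 :=
    HasFDerivAt.comp (f := fun E => 1 + j E) (0 : Fin m → ℝ)
      (hbt.differentiableAt (by simp)).hasFDerivAt hj1
  obtain ⟨ψ, hψ, hψT⟩ := hT.exists_local_leftInverse (by simp) (by
    rw [hT'.fderiv, injective_iff_map_eq_zero]
    intro E hE
    have hmem : j E ∈ bilinDer B := by
      intro x y
      have h1 := fderiv_bilinTransport_one (B := B) (j E) x y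
      have h2 : fderiv ℝ (bilinTransport B) 1 (j E) = 0 := by simpa using hE
      rw [h2] at h1
      simpa using (sub_eq_zero.1 h1.symm).symm
    have : j E ∈ bilinDer B ⊓ C := ⟨hmem, (hjC _).2 ⟨E, rfl⟩⟩
    rw [hC.inf_eq_bot] at this
    exact hj (this.trans (map_zero j).symm))
  simp only [map_zero, add_zero] at hψ
  -- `1 + j (ψ (bilinTransport B Q))` is the representative of the orbit of `Q` in `1 + C`
  let η : (V →L[ℝ] V) → (V →L[ℝ] V) := fun Q =>
    (1 + j (ψ (bilinTransport B Q))) * Ring.inverse Q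
  have hη : ContDiffAt ℝ ω η 1 := by
    have h2 : ContDiffAt ℝ ω (fun Q => ψ (bilinTransport B Q)) 1 :=
      ContDiffAt.comp (1 : V →L[ℝ] V) hψ (contDiffAt_bilinTransport isUnit_one)
    have h3 : ContDiffAt ℝ ω (Ring.inverse : (V →L[ℝ] V) → _) (1 : V →L[ℝ] V) :=
      contDiffAt_ringInverse ℝ (1 : (V →L[ℝ] V)ˣ)
    exact (contDiffAt_const.add (j.contDiff.contDiffAt.comp _ h2)).mul h3
  -- `(δ, E) ↦ exp δ (1 + E)` is open at the origin
  let Θ : (Fin d → ℝ) × (Fin m → ℝ) → (V →L[ℝ] V) := fun p =>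
    NormedSpace.exp (i p.1) * (1 + j p.2)
  have hsurj : (i.coprod j).range = ⊤ := by
    rw [eq_top_iff]
    intro Q _
    obtain ⟨a, ha, b, hb, hab⟩ := Submodule.mem_sup.1 (hC.sup_eq_top ▸ Submodule.mem_top : Q ∈ _)
    obtain ⟨a, rfl⟩ := (hiD a).1 ha
    obtain ⟨b, rfl⟩ := (hjC b).1 hb
    exact ⟨(a, b), by simpa using hab⟩
  have hmap : Filter.map Θ (𝓝 0) = 𝓝 1 := map_nhds_exp_mul_one_add i j hsurj
  refine ⟨η, ?_, ?_, ?_⟩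
  · have : ψ (bilinTransport B (1 + j 0)) = 0 := hψT.self_of_nhds
    simp only [map_zero, add_zero] at this
    simp [η, this]
  · intro k Q hk hQ
    simp only [η]
    rw [bilinTransport_mul_left hk hQ, mul_assoc]
    congr 1
    obtain ⟨k, rfl⟩ := hk.1
    obtain ⟨Q, rfl⟩ := hQ
    rw [← Units.val_mul, Ring.inverse_unit, Ring.inverse_unit]
    simp
  · have hev : ∀ᶠ Q in 𝓝 (1 : V →L[ℝ] V), ContDiffAt ℝ ω η Q := hη.eventually (by simp)
    have hAut : ∀ᶠ Q in 𝓝 (1 : V →L[ℝ] V), IsBilinAut B (η Q) := by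
      rw [← hmap, Filter.eventually_map]
      have hu : ∀ᶠ p : (Fin d → ℝ) × (Fin m → ℝ) in 𝓝 0, IsUnit (1 + j p.2) := by
        have hc : ContinuousAt (fun p : (Fin d → ℝ) × (Fin m → ℝ) => 1 + j p.2) 0 := by fun_prop
        exact hc.eventually (by simpa using hone)
      have hψ2 : ∀ᶠ p : (Fin d → ℝ) × (Fin m → ℝ) in 𝓝 0, ψ (bilinTransport B (1 + j p.2)) = p.2 :=
        (continuous_snd.continuousAt (x := (0 : (Fin d → ℝ) × (Fin m → ℝ)))).eventually
          (by simpa using hψT)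
      filter_upwards [hu, hψ2] with p hp1 hp2
      have hexp := isBilinAut_exp ((hiD _).2 ⟨p.1, rfl⟩)
      have : η (Θ p) = Ring.inverse (NormedSpace.exp (i p.1)) := by
        simp only [η, Θ]
        rw [bilinTransport_mul_left hexp hp1]
        rw [hp2]
        obtain ⟨k, hk⟩ := hexp.1
        obtain ⟨Q, hQ⟩ := hp1
        rw [← hk, ← hQ, ← Units.val_mul, Ring.inverse_unit, Ring.inverse_unit]
        simp
      rw [this]
      exact hexp.inverse
    filter_upwards [hone, hev, hAut] with Q h1 h2 h3
    exact ⟨h1, h3, h2.of_le (by simp)⟩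

end Slice

section Slice

variable {V : Type*} [NormedAddCommGroup V] [NormedSpace ℝ V] [FiniteDimensional ℝ V]
  {W : Type*} [NormedAddCommGroup W] [NormedSpace ℝ W]

theorem ContinuousLinearMap.isUnit_of_surjective {h : V →L[ℝ] V} (hh : Function.Surjective h) :
    IsUnit h := by
  have hi : Function.Injective h.toLinearMap := LinearMap.injective_iff_surjective.2 hh
  let e : V ≃L[ℝ] V := (LinearEquiv.ofBijective h.toLinearMap ⟨hi, hh⟩).toContinuousLinearEquiv
  exact ⟨ContinuousLinearEquiv.toUnit e, rfl⟩

/-- The action of the automorphisms on the surjections `W → V` is proper: the translates of a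
compact set of surjections form a set which is closed among the surjections. -/
theorem isBilinAut_orbit_closed {B : V →L[ℝ] V →L[ℝ] V} {K : Set (W →L[ℝ] V)} (hK : IsCompact K)
    (R : V →L[ℝ] W) (hR : ∀ T ∈ K, IsUnit (T.comp R)) {T : W →L[ℝ] V} (hT : Function.Surjective T)
    (hcl : T ∈ closure {T | ∃ h, IsBilinAut B h ∧ ∃ T' ∈ K, T = h.comp T'}) :
    ∃ h, IsBilinAut B h ∧ ∃ T' ∈ K, T = h.comp T' := by
  have : CompleteSpace V := FiniteDimensional.complete ℝ V
  obtain ⟨S, hS, hSlim⟩ := mem_closure_iff_seq_limit.1 hcl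
  choose h hh k hk hSk using hS
  obtain ⟨T', hT', φ, hφ, hφlim⟩ := hK.tendsto_subseq hk
  have hSφ : Filter.Tendsto (S ∘ φ) Filter.atTop (𝓝 T) := hSlim.comp hφ.tendsto_atTop
  have hcomp : Continuous fun T : W →L[ℝ] V => T.comp R := by fun_prop
  -- the automorphisms `h n` are recovered from `S n` and `k n`, so that they converge as well
  have hh_eq : ∀ n, h (φ n) = ((S (φ n)).comp R) * Ring.inverse ((k (φ n)).comp R) := by
    intro n
    have h1 : (S (φ n)).comp R = h (φ n) * (k (φ n)).comp R := by
      rw [hSk]; rfl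
    rw [h1, mul_assoc, Ring.mul_inverse_cancel _ (hR _ (hk _)), mul_one]
  have hinv : ContinuousAt (Ring.inverse : (V →L[ℝ] V) → _) (T'.comp R) := by
    obtain ⟨u, hu⟩ := hR T' hT'
    rw [← hu]
    exact (contDiffAt_ringInverse (n := 0) ℝ u).continuousAt
  have hhlim : Filter.Tendsto (fun n => h (φ n)) Filter.atTop
      (𝓝 ((T.comp R) * Ring.inverse (T'.comp R))) := by
    simp only [hh_eq]
    exact ((hcomp.tendsto T).comp hSφ).mul
      (hinv.tendsto.comp ((hcomp.tendsto T').comp hφlim))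
  set g := (T.comp R) * Ring.inverse (T'.comp R)
  have hTg : T = g.comp T' := by
    refine tendsto_nhds_unique hSφ ?_
    have h1 : Continuous fun p : (V →L[ℝ] V) × (W →L[ℝ] V) => p.1.comp p.2 := by fun_prop
    have h2 := (h1.tendsto (g, T')).comp (hhlim.prodMk_nhds hφlim)
    refine h2.congr fun n => ?_
    simp [hSk]
  have hgs : Function.Surjective g := by
    intro x
    obtain ⟨w, hw⟩ := hT x
    exact ⟨T' w, by rw [← hw, hTg]; rfl⟩
  refine ⟨g, ⟨ContinuousLinearMap.isUnit_of_surjective hgs, fun x y => ?_⟩, T', hT', hTg⟩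
  have hev : ∀ z, Filter.Tendsto (fun n => h (φ n) z) Filter.atTop (𝓝 (g z)) := fun z =>
    ((ContinuousLinearMap.apply ℝ V z).continuous.tendsto g).comp hhlim
  have h1 : Filter.Tendsto (fun n => B (h (φ n) x) (h (φ n) y)) Filter.atTop
      (𝓝 (B (g x) (g y))) := by
    have hB : Continuous fun p : V × V => B p.1 p.2 := by fun_prop
    exact (hB.tendsto (g x, g y)).comp ((hev x).prodMk_nhds (hev y))
  refine tendsto_nhds_unique (hev (B x y)) (h1.congr fun n => ?_)
  exact ((hh (φ n)).2 x y).symm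

/-- Existence of slices for the action of the automorphisms of `(V, B)` on the surjections `W → V`.
Near `T₀`, the automorphism `θ T` moves `T` along its orbit to a point `θ T ∘ T` which only depends
on the orbit; `β` is an invariant bump function used to extend this construction to all
surjections. -/
theorem exists_slice [FiniteDimensional ℝ W] (B : V →L[ℝ] V →L[ℝ] V) (T₀ : W →L[ℝ] V)
    (hT₀ : Function.Surjective T₀) :
    ∃ (β : (W →L[ℝ] V) → ℝ) (θ : (W →L[ℝ] V) → (V →L[ℝ] V)),
      (∀ T : W →L[ℝ] V, Function.Surjective T → ContDiffAt ℝ ∞ β T ∧ ContDiffAt ℝ ∞ θ T) ∧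
      (∀ (k : V →L[ℝ] V) (T : W →L[ℝ] V), IsBilinAut B k → Function.Surjective T →
        β (k.comp T) = β T ∧ θ (k.comp T) * k = θ T) ∧
      (∀ T : W →L[ℝ] V, Function.Surjective T → β T ≠ 0 → ∃ h, IsBilinAut B h ∧ θ T = β T • h) ∧
      (∀ᶠ T in 𝓝 T₀, β T = 1) ∧ θ T₀ = 1 := by
  classical
  have : CompleteSpace V := FiniteDimensional.complete ℝ V
  obtain ⟨η, hη1, hηinv, hη⟩ := exists_local_bilinAut_correction B
  obtain ⟨U, hU, hUo, hU1⟩ := eventually_nhds_iff.1 hη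
  obtain ⟨R', hR'⟩ := T₀.toLinearMap.exists_rightInverse_of_surjective
    (LinearMap.range_eq_top.2 hT₀)
  let R : V →L[ℝ] W := LinearMap.toContinuousLinearMap R'
  have hR : T₀.comp R = 1 := by
    ext x
    exact congrArg (fun f : V →ₗ[ℝ] V => f x) hR'
  have hcomp : ContDiff ℝ ∞ fun T : W →L[ℝ] V => T.comp R := by fun_prop
  have hUpre : IsOpen ((fun T : W →L[ℝ] V => T.comp R) ⁻¹' U) := hUo.preimage hcomp.continuous
  obtain ⟨r, hr, hrU⟩ := Metric.isOpen_iff.1 hUpre T₀ (by simpa [hR] using hU1)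
  let χ : ContDiffBump T₀ := ⟨r / 4, r / 2, by positivity, by linarith⟩
  have hχU : ∀ T ∈ Metric.closedBall T₀ (r / 2), T.comp R ∈ U := fun T hT =>
    hrU (Metric.closedBall_subset_ball (by linarith) hT)
  -- the union of the orbits which pass near `T₀`; there `T ↦ η (T.comp R)` is defined
  let Wn : Set (W →L[ℝ] V) := {T | ∃ h, IsBilinAut B h ∧ h * T.comp R ∈ U}
  have hWn : IsOpen Wn := by
    have : Wn = ⋃ h ∈ {h | IsBilinAut B h}, (fun T : W →L[ℝ] V => h * T.comp R) ⁻¹' U := by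
      ext T; simp [Wn]
    rw [this]
    exact isOpen_biUnion fun h _ => hUo.preimage (continuous_const.mul hcomp.continuous)
  have hunit : ∀ T ∈ Wn, IsUnit (T.comp R) := by
    rintro T ⟨h, hh, hhU⟩
    have h1 := hh.1.ringInverse.mul (hU _ hhU).1
    rwa [← mul_assoc, Ring.inverse_mul_cancel _ hh.1, one_mul] at h1
  have hηAut : ∀ T ∈ Wn, IsBilinAut B (η (T.comp R)) := by
    rintro T ⟨h, hh, hhU⟩
    rw [← hηinv h _ hh (hunit T ⟨h, hh, hhU⟩)]
    exact (hU _ hhU).2.1.mul hh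
  have hηsmooth : ∀ T ∈ Wn, ContDiffAt ℝ ∞ (fun T : W →L[ℝ] V => η (T.comp R)) T := by
    intro T hT
    obtain ⟨h, hh, hhU⟩ := id hT
    have h1 : ContDiffAt ℝ ∞ (fun T : W →L[ℝ] V => η (h * T.comp R) * h) T := by
      refine ContDiffAt.mul ?_ contDiffAt_const
      exact ContDiffAt.comp (f := fun T : W →L[ℝ] V => h * T.comp R) T (hU _ hhU).2.2
        (contDiffAt_const.mul hcomp.contDiffAt)
    refine h1.congr_of_eventuallyEq ?_
    filter_upwards [hWn.mem_nhds hT] with T' hT'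
    exact (hηinv h _ hh (hunit T' hT')).symm
  have hWinv : ∀ k T, IsBilinAut B k → (k.comp T ∈ Wn ↔ T ∈ Wn) := by
    intro k T hk
    constructor
    · rintro ⟨h, hh, hhU⟩
      exact ⟨h * k, hh.mul hk, hhU⟩
    · rintro ⟨h, hh, hhU⟩
      refine ⟨h * Ring.inverse k, hh.mul hk.inverse, ?_⟩
      have : (k.comp T).comp R = k * T.comp R := rfl
      rwa [this, mul_assoc, ← mul_assoc (Ring.inverse k), Ring.inverse_mul_cancel _ hk.1, one_mul]
  let β : (W →L[ℝ] V) → ℝ := fun T => if T ∈ Wn then χ ((η (T.comp R)).comp T) else 0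
  let θ : (W →L[ℝ] V) → (V →L[ℝ] V) := fun T => β T • η (T.comp R)
  -- the union of the orbits which meet the support of the bump function
  let Z : Set (W →L[ℝ] V) :=
    {T | ∃ h, IsBilinAut B h ∧ ∃ T' ∈ Metric.closedBall T₀ (r / 2), T = h.comp T'}
  have hβZ : ∀ T, β T ≠ 0 → T ∈ Z := by
    intro T hT
    by_cases hTW : T ∈ Wn
    · have h1 : χ ((η (T.comp R)).comp T) ≠ 0 := by simpa [β, hTW] using hT
      have h2 : (η (T.comp R)).comp T ∈ Metric.closedBall T₀ (r / 2) := by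
        have : (η (T.comp R)).comp T ∈ Function.support χ := h1
        rw [χ.support_eq] at this
        exact Metric.ball_subset_closedBall this
      refine ⟨_, (hηAut T hTW).inverse, _, h2, ?_⟩
      ext w
      exact ((hηAut T hTW).1.ringInverse_apply_apply (T w)).symm
    · simp [β, hTW] at hT
  have hZW : Z ⊆ Wn := by
    rintro T ⟨h, hh, T', hT', rfl⟩
    exact (hWinv h T' hh).2 ⟨1, ⟨isUnit_one, fun _ _ => rfl⟩, by simpa using hχU T' hT'⟩
  have hzero : ∀ T : W →L[ℝ] V, Function.Surjective T → T ∉ Wn → ∀ᶠ T' in 𝓝 T, β T' = 0 := by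
    intro T hT hTW
    have h1 : T ∉ closure Z := fun h => hTW (hZW (isBilinAut_orbit_closed
      (isCompact_closedBall T₀ (r / 2)) R (fun T hT => (hU _ (hχU T hT)).1) hT h))
    filter_upwards [isClosed_closure.isOpen_compl.mem_nhds h1] with T' hT'
    by_contra hne
    exact hT' (subset_closure (hβZ T' hne))
  have hβsmooth : ∀ T : W →L[ℝ] V, Function.Surjective T → ContDiffAt ℝ ∞ β T := by
    intro T hT
    by_cases hTW : T ∈ Wn
    · -- the bump function is evaluated at the normalized point, so that it is invariant
      have h1 : ContDiffAt ℝ ∞ (fun T : W →L[ℝ] V => χ ((η (T.comp R)).comp T)) T :=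
        χ.contDiffAt.comp T ((hηsmooth T hTW).clm_comp contDiffAt_id)
      refine h1.congr_of_eventuallyEq ?_
      filter_upwards [hWn.mem_nhds hTW] with T' hT'
      simp [β, hT']
    · exact contDiffAt_const.congr_of_eventuallyEq (hzero T hT hTW)
  have hT₀W : ∀ᶠ T in 𝓝 T₀, T ∈ Wn :=
    hWn.mem_nhds ⟨1, ⟨isUnit_one, fun _ _ => rfl⟩, by simpa [hR] using hU1⟩
  have hηT₀ : (η (T₀.comp R)).comp T₀ = T₀ := by rw [hR, hη1]; rfl
  have hβone : ∀ᶠ T in 𝓝 T₀, β T = 1 := by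
    have hc : ContinuousAt (fun T : W →L[ℝ] V => (η (T.comp R)).comp T) T₀ :=
      ((hηsmooth T₀ hT₀W.self_of_nhds).clm_comp contDiffAt_id).continuousAt
    have h1 := hc.eventually (p := fun y => χ y = 1) (by
      simp only [hηT₀]
      exact χ.eventuallyEq_one)
    filter_upwards [h1, hT₀W] with T hT1 hT2
    simpa [β, hT2] using hT1
  refine ⟨β, θ, fun T hT => ⟨hβsmooth T hT, ?_⟩, ?_, ?_, hβone, ?_⟩
  · by_cases hTW : T ∈ Wn
    · exact (hβsmooth T hT).smul (hηsmooth T hTW)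
    · refine (contDiffAt_const (c := (0 : V →L[ℝ] V))).congr_of_eventuallyEq ?_
      filter_upwards [hzero T hT hTW] with T' hT'
      simp [θ, hT']
  · intro k T hk hT
    by_cases hTW : T ∈ Wn
    · have hkT : k.comp T ∈ Wn := (hWinv k T hk).2 hTW
      have hcomm : η ((k.comp T).comp R) * k = η (T.comp R) := hηinv k _ hk (hunit T hTW)
      have hβ : β (k.comp T) = β T := by
        simp only [β, hTW, hkT, if_true]
        congr 1
        rw [← hcomm]
        rfl
      refine ⟨hβ, ?_⟩
      simp only [θ, hβ, smul_mul_assoc, hcomm]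
    · have hkT : k.comp T ∉ Wn := fun h => hTW ((hWinv k T hk).1 h)
      simp [θ, β, hTW, hkT]
  · intro T _ hβT
    have hTW : T ∈ Wn := hZW (hβZ T hβT)
    exact ⟨_, hηAut T hTW, rfl⟩
  · simp only [θ, hβone.self_of_nhds, hR, hη1, one_smul]

end Slice

/-! ### Tangent vectors as point derivations -/

section PointDerivations

/-- Hadamard's lemma in coordinates. -/
theorem hadamard_pi {k : ℕ} {h : (Fin k → ℝ) → ℝ} (hh : ContDiff ℝ ∞ h) (y₀ : Fin k → ℝ) :
    ∃ l : Fin k → (Fin k → ℝ) → ℝ, (∀ i, ContDiff ℝ ∞ (l i)) ∧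
      (∀ y, h y = h y₀ + ∑ i, (y i - y₀ i) * l i y) ∧
      ∀ i, l i y₀ = fderiv ℝ h y₀ (Pi.single i 1) := by
  obtain ⟨L, hL, hlin, hL1, hL2⟩ := hadamard_parametric (P := ℝ) (F := fun p => h p.2)
    (hh.comp contDiff_snd) y₀
  refine ⟨fun i y => L (0, y) (Pi.single i 1), fun i => (hL _).comp (contDiff_prodMk_right 0),
    ?_, ?_⟩
  · intro y
    have h1 := hL1 0 y
    simp only at h1
    rw [h1]
    congr 1
    have h2 := LinearMap.pi_apply_eq_sum_univ (hlin (0, y)).mk' (y - y₀)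
    simp only [IsLinearMap.mk'_apply] at h2
    rw [h2]
    refine Finset.sum_congr rfl fun i _ => ?_
    simp only [Pi.sub_apply, smul_eq_mul]
    congr 3
    ext j
    simp [Pi.single_apply, eq_comm]
  · intro i
    have h3 : HasFDerivAt (fun p : ℝ × (Fin k → ℝ) => h p.2)
        ((fderiv ℝ h y₀).comp (ContinuousLinearMap.snd ℝ ℝ (Fin k → ℝ))) (0, y₀) :=
      HasFDerivAt.comp (g := h) (f := Prod.snd) ((0 : ℝ), y₀)
        ((hh.differentiable (by simp)) y₀).hasFDerivAt hasFDerivAt_snd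
    exact (hL2 0 _).trans (by rw [h3.fderiv]; rfl)

variable {X : Type*} {S : Subalgebra ℝ (X → ℝ)} {x : X}

/-- A ring of functions is smoothly closed if it is stable under composition with the smooth
functions of several real variables. -/
def SmoothlyClosed (S : Subalgebra ℝ (X → ℝ)) : Prop :=
  ∀ (k : ℕ) (F : Fin k → S) (h : (Fin k → ℝ) → ℝ), ContDiff ℝ ∞ h →
    (fun y => h fun i => (F i).1 y) ∈ S

theorem tangentSpaceAt.apply_algebraMap (v : tangentSpaceAt S x) (c : ℝ) :
    v.1 (algebraMap ℝ S c) = 0 := by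
  have h1 := v.2 1 1
  have h2 : ((1 : S) : X → ℝ) x = 1 := rfl
  simp only [mul_one, h2, one_mul] at h1
  rw [Algebra.algebraMap_eq_smul_one, map_smul]
  have : v.1 1 = 0 := by linarith
  rw [this, smul_zero]

/-- A tangent vector at `x` does not distinguish functions which agree on the support of some
function with value `1` at `x`. -/
theorem tangentSpaceAt.apply_eq_of_mul_eq (v : tangentSpaceAt S x) {F G b : S} (hb : b.1 x = 1)
    (h : ∀ y, b.1 y ≠ 0 → F.1 y = G.1 y) (hx : F.1 x = G.1 x) : v.1 F = v.1 G := by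
  have h1 : b * F = b * G := by
    ext y
    by_cases hy : b.1 y = 0
    · exact (congrArg (· * F.1 y) hy).trans ((zero_mul _).trans
        ((congrArg (· * G.1 y) hy).trans (zero_mul _)).symm)
    · exact congrArg (b.1 y * ·) (h y hy)
  have h2 := v.2 b F
  have h3 := v.2 b G
  rw [h1] at h2
  rw [hb, hx] at h2
  rw [hb] at h3
  linarith

/-- The chain rule for a tangent vector and a smooth function of finitely many functions. -/
theorem tangentSpaceAt.chain_rule (hS : SmoothlyClosed S) (v : tangentSpaceAt S x) {k : ℕ}
    (F : Fin k → S) {h : (Fin k → ℝ) → ℝ} (hh : ContDiff ℝ ∞ h) :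
    v.1 ⟨_, hS k F h hh⟩ = ∑ i, fderiv ℝ h (fun i => (F i).1 x) (Pi.single i 1) * v.1 (F i) := by
  set y₀ : Fin k → ℝ := fun i => (F i).1 x
  obtain ⟨l, hl, hl1, hl2⟩ := hadamard_pi hh y₀
  have key : (⟨_, hS k F h hh⟩ : S) = algebraMap ℝ S (h y₀) +
      ∑ i, (F i - algebraMap ℝ S (y₀ i)) * ⟨_, hS k F (l i) (hl i)⟩ := by
    ext y
    have h1 : (∑ i, (F i - algebraMap ℝ S (y₀ i)) * (⟨_, hS k F (l i) (hl i)⟩ : S)).1 y =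
        ∑ i, ((F i).1 y - y₀ i) * l i fun i => (F i).1 y := by
      exact map_sum ((Pi.evalAlgHom ℝ (fun _ : X => ℝ) y).comp S.val) _ _
    change h _ = h y₀ + (∑ i, (F i - algebraMap ℝ S (y₀ i)) *
      (⟨_, hS k F (l i) (hl i)⟩ : S)).1 y
    rw [h1, hl1]
  rw [key, map_add, tangentSpaceAt.apply_algebraMap, zero_add, map_sum]
  refine Finset.sum_congr rfl fun i _ => ?_
  rw [v.2, map_sub, tangentSpaceAt.apply_algebraMap, sub_zero, ← hl2 i]
  have h0 : (F i - algebraMap ℝ S (y₀ i)).1 x = 0 := sub_self ((F i).1 x)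
  rw [h0, zero_mul, zero_add]

end PointDerivations

/-! ### Smooth functions of regular points and of jets -/

section RegularPoints

variable {n : ℕ} {M : Type*} [TopologicalSpace M] [ChartedSpace (EuclideanSpace ℝ (Fin n)) M]
  {A : Type*} [CommRing A] [Algebra ℝ A]

theorem nhds_regularPoint (q : RegularPoint n M A) :
    𝓝 q = Filter.comap (fun q' (p : SmoothRing n M × Module.Dual ℝ A) => realComponent p.1 p.2 q')
      (𝓝 fun p : SmoothRing n M × Module.Dual ℝ A => realComponent p.1 p.2 q) := by
  have h : (inferInstance : TopologicalSpace (RegularPoint n M A)) =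
      TopologicalSpace.induced (fun q' (p : SmoothRing n M × Module.Dual ℝ A) =>
        realComponent p.1 p.2 q') (⨅ p : SmoothRing n M × Module.Dual ℝ A,
          TopologicalSpace.induced (fun c => c p) inferInstance) := by
    rw [induced_iInf, iInf_prod]
    simp only [induced_compose]
    rfl
  exact (congrArg (fun t => @nhds _ t q) h).trans (nhds_induced _ q)

theorem continuous_realComponent (f : SmoothRing n M) (w : Module.Dual ℝ A) :
    Continuous (realComponent (n := n) (M := M) (A := A) f w) := by
  rw [continuous_iff_continuousAt]
  intro q
  rw [ContinuousAt, nhds_regularPoint]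
  have h : Continuous fun c : SmoothRing n M × Module.Dual ℝ A → ℝ => c (f, w) :=
    continuous_apply (f, w)
  exact (h.tendsto _).comp Filter.tendsto_comap

theorem tendsto_nhds_regularPoint {α : Type*} {l : Filter α} {c : α → RegularPoint n M A}
    {q : RegularPoint n M A} : Filter.Tendsto c l (𝓝 q) ↔
      ∀ f w, Filter.Tendsto (fun a => realComponent f w (c a)) l (𝓝 (realComponent f w q)) := by
  rw [nhds_regularPoint, Filter.tendsto_comap_iff, tendsto_pi_nhds]
  exact ⟨fun h f w => h (f, w), fun h p => h p.1 p.2⟩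

/-- Finitely many real components suffice to describe a neighbourhood of a regular point. -/
theorem exists_realComponent_nhds {q : RegularPoint n M A} {N : Set (RegularPoint n M A)}
    (hN : N ∈ 𝓝 q) : ∃ (k : ℕ) (f : Fin k → SmoothRing n M) (w : Fin k → Module.Dual ℝ A)
      (O : Set (Fin k → ℝ)), IsOpen O ∧ (fun i => realComponent (f i) (w i) q) ∈ O ∧
      ∀ q', (fun i => realComponent (f i) (w i) q') ∈ O → q' ∈ N := by
  rw [nhds_regularPoint, Filter.mem_comap] at hN
  obtain ⟨t, ht, htN⟩ := hN
  rw [nhds_pi, Filter.mem_pi] at ht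
  obtain ⟨I, hI, s, hs, hst⟩ := ht
  choose o hos hoo hmem using fun p => mem_nhds_iff.1 (hs p)
  have : Fintype I := hI.fintype
  let e := Fintype.equivFin I
  refine ⟨Fintype.card I, fun i => (e.symm i).1.1, fun i => (e.symm i).1.2,
    Set.univ.pi fun i => o (e.symm i).1, isOpen_set_pi Set.finite_univ fun i _ => hoo _,
    fun i _ => hmem _, fun q' hq' => htN (hst fun p hp => hos p ?_)⟩
  have := hq' (e ⟨p, hp⟩) trivial
  simpa using this

theorem SmoothAtRegularPoint.of_fintype {ι : Type*} [Fintype ι] {F : RegularPoint n M A → ℝ}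
    {q : RegularPoint n M A} (f : ι → SmoothRing n M) (w : ι → Module.Dual ℝ A)
    {h : (ι → ℝ) → ℝ} (hh : ContDiff ℝ ∞ h)
    (hF : ∀ᶠ q' in 𝓝 q, F q' = h fun i => realComponent (f i) (w i) q') :
    SmoothAtRegularPoint F q := by
  let e := Fintype.equivFin ι
  refine ⟨Fintype.card ι, f ∘ e.symm, w ∘ e.symm, fun y => h fun i => y (e i),
    hh.comp (contDiff_pi.2 fun i => contDiff_apply ℝ ℝ _), ?_⟩
  filter_upwards [hF] with q' hq'
  simp [hq']

theorem SmoothAtRegularPoint.continuousAt {F : RegularPoint n M A → ℝ} {q : RegularPoint n M A}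
    (hF : SmoothAtRegularPoint F q) : ContinuousAt F q := by
  obtain ⟨k, f, w, h, hh, hE⟩ := hF
  have h1 : Continuous fun q' => h fun i => realComponent (f i) (w i) q' :=
    hh.continuous.comp (continuous_pi fun i => continuous_realComponent _ _)
  exact h1.continuousAt.congr (hE.mono fun _ h => h.symm)

theorem SmoothAtRegularPoint.congr {F G : RegularPoint n M A → ℝ} {q : RegularPoint n M A}
    (hF : SmoothAtRegularPoint F q) (h : ∀ᶠ q' in 𝓝 q, G q' = F q') :
    SmoothAtRegularPoint G q := by
  obtain ⟨k, f, w, h', hh, hE⟩ := hF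
  exact ⟨k, f, w, h', hh, by filter_upwards [h, hE] with q' h1 h2; rw [h1, h2]⟩

theorem SmoothAtRegularPoint.comp_contDiff {ι : Type*} [Fintype ι]
    {F : ι → RegularPoint n M A → ℝ} {q : RegularPoint n M A}
    (hF : ∀ i, SmoothAtRegularPoint (F i) q) {h : (ι → ℝ) → ℝ} (hh : ContDiff ℝ ∞ h) :
    SmoothAtRegularPoint (fun q' => h fun i => F i q') q := by
  choose k f w g hg hE using hF
  refine SmoothAtRegularPoint.of_fintype (ι := Σ i, Fin (k i)) (fun p => f p.1 p.2)
    (fun p => w p.1 p.2) (h := fun y => h fun i => g i fun j => y ⟨i, j⟩) ?_ ?_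
  · exact hh.comp (contDiff_pi.2 fun i => (hg i).comp (contDiff_pi.2 fun j => contDiff_apply ℝ ℝ _))
  · filter_upwards [Filter.eventually_all.2 hE] with q' hq'
    simp only [hq']

/-- A function which is smooth near a point agrees near the point with a smooth function. -/
theorem exists_contDiff_eventuallyEq {E : Type*} [NormedAddCommGroup E] [NormedSpace ℝ E]
    [FiniteDimensional ℝ E] {h : E → ℝ} {y : E} (hh : ∀ᶠ y' in 𝓝 y, ContDiffAt ℝ ∞ h y') :
    ∃ g : E → ℝ, ContDiff ℝ ∞ g ∧ g =ᶠ[𝓝 y] h := by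
  obtain ⟨r, hr, hball⟩ := Metric.eventually_nhds_iff_ball.1 hh
  let χ : ContDiffBump y := ⟨r / 4, r / 2, by positivity, by linarith⟩
  refine ⟨fun y' => χ y' * h y', ?_, ?_⟩
  · rw [contDiff_iff_contDiffAt]
    intro y'
    by_cases hy : y' ∈ Metric.ball y r
    · exact χ.contDiffAt.mul (hball y' hy)
    · refine (contDiffAt_const (c := (0 : ℝ))).congr_of_eventuallyEq ?_
      have : y' ∉ tsupport χ := by
        rw [χ.tsupport_eq]
        exact fun h => hy (Metric.closedBall_subset_ball (by simp [χ]; linarith) h)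
      filter_upwards [(isClosed_tsupport χ).isOpen_compl.mem_nhds this] with z hz
      rw [image_eq_zero_of_notMem_tsupport hz, zero_mul]
  · filter_upwards [χ.eventuallyEq_one] with z hz
    rw [hz, Pi.one_apply, one_mul]

theorem SmoothAtRegularPoint.comp_contDiffAt {ι : Type*} [Fintype ι]
    {F : ι → RegularPoint n M A → ℝ} {q : RegularPoint n M A}
    (hF : ∀ i, SmoothAtRegularPoint (F i) q) {h : (ι → ℝ) → ℝ}
    (hh : ∀ᶠ y in 𝓝 (fun i => F i q), ContDiffAt ℝ ∞ h y) :
    SmoothAtRegularPoint (fun q' => h fun i => F i q') q := by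
  obtain ⟨g, hg, hgh⟩ := exists_contDiff_eventuallyEq hh
  refine (SmoothAtRegularPoint.comp_contDiff hF hg).congr ?_
  have hc : ContinuousAt (fun q' i => F i q') q := continuousAt_pi.2 fun i => (hF i).continuousAt
  filter_upwards [hc.eventually hgh] with q' hq'
  exact hq'.symm

theorem smoothlyClosed_smoothOnRegularPoints : SmoothlyClosed (smoothOnRegularPoints n M A) :=
  fun _ F _ hh q => SmoothAtRegularPoint.comp_contDiff (fun i => (F i).2 q) hh

theorem smoothlyClosed_smoothOnJets : SmoothlyClosed (smoothOnJets n M A) :=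
  fun _ F _ hh q => SmoothAtRegularPoint.comp_contDiff (fun i => (kerPullback (F i)).2 q) hh

/-- Tangent vectors at a regular point only depend on germs. -/
theorem tangentSpaceAt.apply_eq_of_eventuallyEq {q : RegularPoint n M A}
    (v : tangentSpaceAt (smoothOnRegularPoints n M A) q) {F G : smoothOnRegularPoints n M A}
    (h : ∀ᶠ q' in 𝓝 q, F.1 q' = G.1 q') : v.1 F = v.1 G := by
  obtain ⟨k, f, w, O, hO, hqO, hON⟩ := exists_realComponent_nhds h
  obtain ⟨χ, hχ, -, hχs, -, hχ1⟩ := exists_contDiff_tsupport_subset (n := ⊤) (hO.mem_nhds hqO)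
  refine tangentSpaceAt.apply_eq_of_mul_eq v (b := ⟨_, smoothlyClosed_smoothOnRegularPoints k
    (fun i => ⟨realComponent (f i) (w i), realComponent_smooth (f i) (w i)⟩) χ hχs⟩) hχ1 ?_
    h.self_of_nhds
  exact fun q' hq' => hON q' (hχ (subset_tsupport _ hq'))

theorem tangentSpaceAt.chain_rule_realComponent {q : RegularPoint n M A}
    (v : tangentSpaceAt (smoothOnRegularPoints n M A) q) {F : smoothOnRegularPoints n M A} {k : ℕ}
    {f : Fin k → SmoothRing n M} {w : Fin k → Module.Dual ℝ A} {h : (Fin k → ℝ) → ℝ}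
    (hh : ContDiff ℝ ∞ h) (hF : ∀ᶠ q' in 𝓝 q, F.1 q' = h fun i => realComponent (f i) (w i) q') :
    v.1 F = ∑ i, fderiv ℝ h (fun i => realComponent (f i) (w i) q) (Pi.single i 1) *
      v.1 ⟨realComponent (f i) (w i), realComponent_smooth (f i) (w i)⟩ := by
  rw [← tangentSpaceAt.chain_rule smoothlyClosed_smoothOnRegularPoints v
    (fun i => ⟨realComponent (f i) (w i), realComponent_smooth (f i) (w i)⟩) hh]
  exact tangentSpaceAt.apply_eq_of_eventuallyEq v hF

end RegularPoints

/-! ### Local coordinates and Hadamard's lemma on a manifold -/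

section LocalCoordinates

/-- Hadamard's lemma with a real parameter, in Euclidean coordinates. -/
theorem hadamard_euclidean {n : ℕ} {F : ℝ × EuclideanSpace ℝ (Fin n) → ℝ} (hF : ContDiff ℝ ∞ F)
    (y₀ : EuclideanSpace ℝ (Fin n)) :
    ∃ G : Fin n → ℝ × EuclideanSpace ℝ (Fin n) → ℝ, (∀ i, ContDiff ℝ ∞ (G i)) ∧
      ∀ t y, F (t, y) = F (t, y₀) + ∑ i, (y i - y₀ i) * G i (t, y) := by
  obtain ⟨L, hL, hlin, hL1, -⟩ := hadamard_parametric hF y₀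
  refine ⟨fun i z => L z (EuclideanSpace.single i 1), fun i => hL _, fun t y => ?_⟩
  rw [hL1 t y]
  congr 1
  have h1 : y - y₀ = ∑ i, (y i - y₀ i) • EuclideanSpace.single i (1 : ℝ) := by
    ext j
    simp [Pi.single_apply]
  have h2 := congrArg (hlin (t, y)).mk' h1
  rw [map_sum] at h2
  simpa using h2

variable {n : ℕ} {M : Type*} [TopologicalSpace M] [ChartedSpace (EuclideanSpace ℝ (Fin n)) M]

theorem SmoothRing.sum_apply {ι : Type*} (s : Finset ι) (f : ι → SmoothRing n M) (x : M) :
    (∑ i ∈ s, f i) x = ∑ i ∈ s, f i x :=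
  map_sum (ContMDiffMap.evalRingHom x : SmoothRing n M →+* ℝ) f s

variable [IsManifold (𝓡 n) ∞ M]

theorem contMDiffAt_comp_chartAt {x x' : M}
    (hx' : x' ∈ (chartAt (EuclideanSpace ℝ (Fin n)) x).source)
    {h : EuclideanSpace ℝ (Fin n) → ℝ} (hh : ContDiff ℝ ∞ h) :
    ContMDiffAt (𝓡 n) 𝓘(ℝ, ℝ) ∞ (fun y => h (chartAt (EuclideanSpace ℝ (Fin n)) x y)) x' :=
  hh.contMDiff.contMDiffAt.comp x' ((contMDiffOn_chart (I := 𝓡 n)).contMDiffAt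
    ((chartAt (EuclideanSpace ℝ (Fin n)) x).open_source.mem_nhds hx'))

/-- A smooth function on `M` read in a chart and cut off inside its target. -/
theorem contDiff_cutoff_comp_symm {x : M} {B : EuclideanSpace ℝ (Fin n) → ℝ} (hB : ContDiff ℝ ∞ B)
    (hBt : tsupport B ⊆ (chartAt (EuclideanSpace ℝ (Fin n)) x).target) (f : SmoothRing n M) :
    ContDiff ℝ ∞ fun y => B y * f ((chartAt (EuclideanSpace ℝ (Fin n)) x).symm y) := by
  rw [← contMDiff_iff_contDiff]
  refine contMDiff_of_tsupport fun y hy => ?_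
  have hy' : y ∈ (chartAt (EuclideanSpace ℝ (Fin n)) x).target := hBt (tsupport_mul_subset_left hy)
  refine hB.contMDiff.contMDiffAt.mul (f.contMDiff.contMDiffAt.comp y ?_)
  exact (contMDiffOn_chart_symm (I := 𝓡 n)).contMDiffAt
    ((chartAt (EuclideanSpace ℝ (Fin n)) x).open_target.mem_nhds hy')

variable [T2Space M] [SecondCountableTopology M]

theorem exists_smoothRing_bump {x : M} {U : Set M} (hU : U ∈ 𝓝 x) :
    ∃ ρ : SmoothRing n M, (∀ᶠ y in 𝓝 x, ρ y = 1) ∧ tsupport ρ ⊆ U := by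
  have : LocallyCompactSpace M := Manifold.locallyCompact_of_finiteDimensional (𝓡 n)
  obtain ⟨t, ht, htc, htU⟩ := exists_mem_nhds_isClosed_subset hU
  obtain ⟨ρ, h1, h0, -⟩ := exists_contMDiffMap_one_nhds_of_subset_interior (𝓡 n) (n := ⊤)
    (isClosed_singleton (x := x)) (Set.singleton_subset_iff.2 (mem_interior_iff_mem_nhds.2 ht))
  refine ⟨ρ, by simpa using h1, (closure_minimal (fun y hy => ?_) htc).trans htU⟩
  by_contra h
  exact hy (h0 y h)

/-- A smooth function defined near a point coincides near the point with a global one. -/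
theorem exists_smoothRing_eventuallyEq {x : M} {U : Set M} (hU : U ∈ 𝓝 x) {g : M → ℝ}
    (hg : ∀ y ∈ U, ContMDiffAt (𝓡 n) 𝓘(ℝ, ℝ) ∞ g y) :
    ∃ f : SmoothRing n M, ∀ᶠ y in 𝓝 x, f y = g y := by
  obtain ⟨ρ, h1, hρ⟩ := exists_smoothRing_bump (n := n) hU
  refine ⟨⟨fun y => ρ y * g y, contMDiff_of_tsupport fun y hy => ?_⟩, ?_⟩
  · have hy' : y ∈ tsupport ρ := tsupport_mul_subset_left hy
    exact ρ.contMDiff.contMDiffAt.mul (hg y (hρ hy'))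
  · filter_upwards [h1] with y hy
    simp [hy]

theorem exists_smoothRing_eventuallyEq_chartAt {x x' : M}
    (hx' : x' ∈ (chartAt (EuclideanSpace ℝ (Fin n)) x).source)
    {h : EuclideanSpace ℝ (Fin n) → ℝ} (hh : ContDiff ℝ ∞ h) :
    ∃ f : SmoothRing n M,
      ∀ᶠ y in 𝓝 x', f y = h (chartAt (EuclideanSpace ℝ (Fin n)) x y) :=
  exists_smoothRing_eventuallyEq
    ((chartAt (EuclideanSpace ℝ (Fin n)) x).open_source.mem_nhds hx')
    fun _ hy => contMDiffAt_comp_chartAt hy hh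

theorem exists_contDiff_bump {y : EuclideanSpace ℝ (Fin n)} {U : Set (EuclideanSpace ℝ (Fin n))}
    (hU : U ∈ 𝓝 y) : ∃ B : EuclideanSpace ℝ (Fin n) → ℝ, ContDiff ℝ ∞ B ∧
      (∀ᶠ z in 𝓝 y, B z = 1) ∧ tsupport B ⊆ U := by
  obtain ⟨ρ, h1, hρ⟩ := exists_smoothRing_bump (n := n) hU
  exact ⟨ρ, ρ.contMDiff.contDiff, h1, hρ⟩

/-- Hadamard's lemma at the points of a chart domain. -/
theorem hadamard_chartAt {x x' : M} (hx' : x' ∈ (chartAt (EuclideanSpace ℝ (Fin n)) x).source)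
    (g : SmoothRing n M) :
    ∃ G : Fin n → SmoothRing n M, ∀ᶠ y in 𝓝 x', g y = g x' +
      ∑ i, (chartAt (EuclideanSpace ℝ (Fin n)) x y i - chartAt (EuclideanSpace ℝ (Fin n)) x x' i) *
        G i y := by
  set φ := chartAt (EuclideanSpace ℝ (Fin n)) x
  obtain ⟨B, hB, hB1, hBt⟩ := exists_contDiff_bump (φ.open_target.mem_nhds (φ.map_source hx'))
  have hh := contDiff_cutoff_comp_symm hB hBt g
  obtain ⟨G, hG, hGF⟩ := hadamard_euclidean
    (F := fun p : ℝ × EuclideanSpace ℝ (Fin n) => B p.2 * g (φ.symm p.2))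
    (hh.comp contDiff_snd) (φ x')
  choose G' hG' using fun i => exists_smoothRing_eventuallyEq_chartAt (n := n) (x := x) hx'
    ((hG i).comp (contDiff_prodMk_right (0 : ℝ)))
  refine ⟨G', ?_⟩
  have hφ : ContinuousAt φ x' := φ.continuousAt hx'
  filter_upwards [Filter.eventually_all.2 hG', hφ.eventually hB1, φ.open_source.mem_nhds hx']
    with y hy hBy hys
  have h1 := hGF 0 (φ y)
  simp only [hBy, hB1.self_of_nhds, one_mul, φ.left_inv hys, φ.left_inv hx'] at h1
  rw [h1]
  congr 1
  exact Finset.sum_congr rfl fun i _ => by rw [hy i]; rfl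

/-- Local coordinates at `x` extended to global functions `X`; Hadamard's lemma holds in terms of
them at all points where the bump function `ρ` does not vanish. -/
theorem exists_coordinates (x : M) : ∃ (X : Fin n → SmoothRing n M) (ρ : SmoothRing n M), ρ x = 1 ∧
    (∀ x', ρ x' ≠ 0 → ∀ g : SmoothRing n M, ∃ G : Fin n → SmoothRing n M,
      ∀ᶠ y in 𝓝 x', g y = g x' + ∑ i, (X i y - X i x') * G i y) ∧
    ∀ i, ∀ᶠ y in 𝓝 x, X i y = chartAt (EuclideanSpace ℝ (Fin n)) x y i := by
  set φ := chartAt (EuclideanSpace ℝ (Fin n)) x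
  have hx : x ∈ φ.source := mem_chart_source _ x
  have hcoord : ∀ i : Fin n, ContDiff ℝ ∞ fun y : EuclideanSpace ℝ (Fin n) => y i := fun i =>
    (EuclideanSpace.proj i : EuclideanSpace ℝ (Fin n) →L[ℝ] ℝ).contDiff
  choose X hX using fun i => exists_smoothRing_eventuallyEq_chartAt hx (hcoord i)
  obtain ⟨U, hUX, hU, hxU⟩ := eventually_nhds_iff.1
    ((Filter.eventually_all.2 hX).and (φ.open_source.mem_nhds hx))
  obtain ⟨ρ, h1, hρ⟩ := exists_smoothRing_bump (n := n) (hU.mem_nhds hxU)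
  refine ⟨X, ρ, h1.self_of_nhds, fun x' hx' g => ?_, hX⟩
  have hx'U : x' ∈ U := hρ (subset_tsupport _ hx')
  obtain ⟨G, hG⟩ := hadamard_chartAt (hUX x' hx'U).2 g
  refine ⟨G, ?_⟩
  filter_upwards [hG, hU.mem_nhds hx'U] with y hy hyU
  rw [hy]
  simp only [(hUX y hyU).1, (hUX x' hx'U).1]

/-- Every real character of the ring of smooth functions is the evaluation at a point. -/
theorem exists_eq_eval (χ : SmoothRing n M →ₐ[ℝ] ℝ) : ∃ x : M, ∀ f, χ f = f x := by
  have : LocallyCompactSpace M := Manifold.locallyCompact_of_finiteDimensional (𝓡 n)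
  let K : CompactExhaustion M := default
  -- a smooth function with compact sublevel sets
  obtain ⟨p, hp⟩ := exists_contMDiffMap_forall_mem_convex_of_local_const (𝓡 n) (n := ⊤)
    (F := ℝ) (t := fun x => Set.Ici (K.find x : ℝ)) (fun x => convex_Ici _) (fun x => by
      refine ⟨(K.find x + 1 : ℕ), ?_⟩
      filter_upwards [isOpen_interior.mem_nhds
        (K.subset_interior_succ _ (K.mem_find x))] with y hy
      exact Set.mem_Ici.2 (Nat.cast_le.2 (K.mem_iff_find_le.1 (interior_subset hy))))
  let p : SmoothRing n M := p
  by_contra! hcon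
  choose g hg using hcon
  let G : M → SmoothRing n M := fun x => g x - algebraMap ℝ _ (χ (g x))
  have hGχ : ∀ x, χ (G x) = 0 := fun x => by simp [G]
  have hGx : ∀ x, G x x ≠ 0 := fun x => sub_ne_zero.2 (hg x).symm
  obtain ⟨N, hN⟩ := exists_nat_ge (χ p)
  obtain ⟨s, hs⟩ := (K.isCompact N).elim_nhds_subcover (fun x => {y | G x y ≠ 0})
    fun x _ => (G x).contMDiff.continuous.continuousAt.eventually_ne (hGx x)
  -- a nowhere vanishing function in the kernel of `χ`: a contradiction
  let H : SmoothRing n M := (p - algebraMap ℝ _ (χ p)) ^ 2 + ∑ x ∈ s, G x ^ 2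
  have hHχ : χ H = 0 := by simp [H, hGχ]
  have hHval : ∀ y, H y = (p y - χ p) ^ 2 + ∑ x ∈ s, G x y ^ 2 := fun y =>
    congrArg ((p y - χ p) ^ 2 + ·) (SmoothRing.sum_apply s _ y)
  have hH0 : ∀ y, H y ≠ 0 := by
    intro y
    rw [hHval]
    have hsum : 0 ≤ ∑ x ∈ s, G x y ^ 2 := Finset.sum_nonneg fun _ _ => sq_nonneg _
    by_cases hy : y ∈ K N
    · obtain ⟨x, hx, hxy⟩ := Set.mem_iUnion₂.1 (hs.2 hy)
      have h1 : 0 < ∑ x ∈ s, G x y ^ 2 :=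
        Finset.sum_pos' (fun _ _ => sq_nonneg _) ⟨x, hx, by
          have : G x y ≠ 0 := hxy
          positivity⟩
      positivity
    · have h1 : (N : ℝ) < K.find y := by
        rw [K.mem_iff_find_le, not_le] at hy
        exact_mod_cast hy
      have h2 : (K.find y : ℝ) ≤ p y := hp y
      have h3 : 0 < (p y - χ p) ^ 2 := by
        have : 0 < p y - χ p := by linarith
        positivity
      positivity
  let H' : SmoothRing n M := ⟨fun y => (H y)⁻¹, H.contMDiff.inv₀ hH0⟩
  have hHH' : H * H' = 1 := by
    ext y
    exact mul_inv_cancel₀ (hH0 y)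
  have := congrArg χ hHH'
  rw [map_mul, hHχ, zero_mul, map_one] at this
  exact zero_ne_one this

end LocalCoordinates

/-! ### Weil algebras and the base point of a point with values in a Weil algebra -/

section WeilAlgebra

variable (A : Type*) [CommRing A] [Algebra ℝ A] [IsWeilAlgebra A]

/-- The augmentation `A → A/𝔪 = ℝ` of a Weil algebra. -/
def weilAugmentation : A →ₐ[ℝ] ℝ :=
  ((AlgEquiv.ofBijective (Algebra.ofId ℝ (IsLocalRing.ResidueField A))
    ⟨(algebraMap ℝ (IsLocalRing.ResidueField A)).injective,
      IsWeilAlgebra.rational⟩).symm : _ →ₐ[ℝ] ℝ).comp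
    (IsScalarTower.toAlgHom ℝ A (IsLocalRing.ResidueField A))

variable {A}

theorem weilAugmentation_eq_zero_iff {a : A} :
    weilAugmentation A a = 0 ↔ a ∈ IsLocalRing.maximalIdeal A := by
  rw [← IsLocalRing.residue_eq_zero_iff]
  simp only [weilAugmentation, AlgHom.comp_apply]
  exact map_eq_zero_iff _ (AlgEquiv.injective _)

theorem isUnit_of_weilAugmentation_ne_zero {a : A} (ha : weilAugmentation A a ≠ 0) : IsUnit a := by
  by_contra h
  exact ha (weilAugmentation_eq_zero_iff.2 ((IsLocalRing.mem_maximalIdeal a).2 h))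

theorem sub_algebraMap_weilAugmentation_mem (a : A) :
    a - algebraMap ℝ A (weilAugmentation A a) ∈ IsLocalRing.maximalIdeal A := by
  rw [← weilAugmentation_eq_zero_iff]
  simp

variable (A) in
theorem exists_maximalIdeal_pow_eq_bot : ∃ N, IsLocalRing.maximalIdeal A ^ N = ⊥ := by
  have : IsArtinianRing A := IsArtinianRing.of_finite ℝ A
  obtain ⟨N, hN⟩ := IsArtinianRing.isNilpotent_jacobson_bot (R := A)
  rw [IsLocalRing.jacobson_eq_maximalIdeal ⊥ bot_ne_top] at hN
  exact ⟨N, hN⟩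

/-- If the elements `aᵢ ∈ S ∩ 𝔪` generate the maximal ideal `𝔪`, then `S ^ N = A` as soon as
`𝔪 ^ N = 0`. -/
theorem Submodule.pow_eq_top_of_generators {n N : ℕ} (hN : IsLocalRing.maximalIdeal A ^ N = ⊥)
    {S : Submodule ℝ A} (hS : 1 ≤ S) {a : Fin n → A} (haS : ∀ i, a i ∈ S)
    (ham : ∀ i, a i ∈ IsLocalRing.maximalIdeal A)
    (hgen : ∀ b : A, ∃ (c : ℝ) (b' : Fin n → A), b = algebraMap ℝ A c + ∑ i, a i * b' i) :
    S ^ N = ⊤ := by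
  have key : ∀ j k, k + j = N → ∀ s ∈ S ^ k, s ∈ IsLocalRing.maximalIdeal A ^ k →
      ∀ b, s * b ∈ S ^ N := by
    intro j
    induction j with
    | zero =>
      intro k hk s _ hs b
      rw [add_zero] at hk
      rw [hk, hN, Ideal.mem_bot] at hs
      rw [hs, zero_mul]
      exact zero_mem _
    | succ j ih =>
      intro k hk s hsS hsm b
      obtain ⟨c, b', hb⟩ := hgen b
      rw [hb, mul_add, Finset.mul_sum]
      refine add_mem ?_ (sum_mem fun i _ => ?_)
      · rw [mul_comm, ← Algebra.smul_def]
        exact Submodule.smul_mem _ _ (pow_le_pow_right' hS (by omega) hsS)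
      · rw [← mul_assoc]
        refine ih (k + 1) (by omega) _ ?_ ?_ _
        · rw [pow_succ]
          exact Submodule.mul_mem_mul hsS (haS i)
        · rw [pow_succ]
          exact Ideal.mul_mem_mul hsm (ham i)
  rw [eq_top_iff]
  intro b _
  simpa using key N 0 (by simp) 1 (by simp) (by simp) b

end WeilAlgebra

section BasePoint

variable {n : ℕ} {M : Type*} [TopologicalSpace M] [ChartedSpace (EuclideanSpace ℝ (Fin n)) M]
  {A : Type*} [CommRing A] [Algebra ℝ A] [IsWeilAlgebra A]

theorem SmoothRing.add_sum_mul_apply {ι : Type*} [Fintype ι] (c : ℝ) (X G : ι → SmoothRing n M)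
    (a : ι → ℝ) (y : M) :
    (algebraMap ℝ (SmoothRing n M) c +
      ∑ i, (X i - algebraMap ℝ (SmoothRing n M) (a i)) * G i) y =
      c + ∑ i, (X i y - a i) * G i y := by
  change c + (∑ i, (X i - algebraMap ℝ (SmoothRing n M) (a i)) * G i) y = _
  rw [SmoothRing.sum_apply]
  rfl

/-- `x` is the base point of the `A`-point `q`: the residue of `q f` is `f x`. -/
def IsBasePoint (q : SmoothRing n M →ₐ[ℝ] A) (x : M) : Prop :=
  ∀ f, weilAugmentation A (q f) = f x

variable {q : SmoothRing n M →ₐ[ℝ] A} {x : M}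

theorem IsBasePoint.sub_mem (hq : IsBasePoint q x) (f : SmoothRing n M) :
    q f - algebraMap ℝ A (f x) ∈ IsLocalRing.maximalIdeal A := by
  rw [← hq f]
  exact sub_algebraMap_weilAugmentation_mem _

variable [IsManifold (𝓡 n) ∞ M] [T2Space M] [SecondCountableTopology M]

theorem exists_isBasePoint (q : SmoothRing n M →ₐ[ℝ] A) : ∃ x, IsBasePoint q x :=
  exists_eq_eval ((weilAugmentation A).comp q)

theorem exists_mul_eq_mul_of_eventuallyEq {f g : SmoothRing n M} (h : ∀ᶠ y in 𝓝 x, f y = g y) :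
    ∃ ρ : SmoothRing n M, ρ x = 1 ∧ ρ * (f - g) = 0 := by
  obtain ⟨ρ, h1, hρ⟩ := exists_smoothRing_bump (n := n) h
  refine ⟨ρ, h1.self_of_nhds, ?_⟩
  ext y
  change ρ y * (f y - g y) = 0
  by_cases hy : ρ y = 0
  · rw [hy, zero_mul]
  · have : f y = g y := hρ (subset_tsupport _ hy)
    rw [this, sub_self, mul_zero]

/-- An `A`-point only depends on germs at its base point. -/
theorem IsBasePoint.apply_eq_of_eventuallyEq (hq : IsBasePoint q x) {f g : SmoothRing n M}
    (h : ∀ᶠ y in 𝓝 x, f y = g y) : q f = q g := by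
  obtain ⟨ρ, hρ, hfg⟩ := exists_mul_eq_mul_of_eventuallyEq h
  have h1 : q ρ * q (f - g) = 0 := by rw [← map_mul, hfg, map_zero]
  have hu : IsUnit (q ρ) := isUnit_of_weilAugmentation_ne_zero (by rw [hq ρ, hρ]; exact one_ne_zero)
  rw [hu.mul_right_eq_zero, map_sub, sub_eq_zero] at h1
  exact h1

theorem IsBasePoint.derivation_apply_eq_of_eventuallyEq (hq : IsBasePoint q x)
    {d : SmoothRing n M →ₗ[ℝ] A} (hd : ∀ f g, d (f * g) = q f * d g + q g * d f)
    {f g : SmoothRing n M} (h : ∀ᶠ y in 𝓝 x, f y = g y) : d f = d g := by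
  obtain ⟨ρ, hρ, hfg⟩ := exists_mul_eq_mul_of_eventuallyEq h
  have h1 := hd ρ (f - g)
  have h2 : q (f - g) = 0 := by rw [map_sub, hq.apply_eq_of_eventuallyEq h, sub_self]
  have hu : IsUnit (q ρ) := isUnit_of_weilAugmentation_ne_zero (by rw [hq ρ, hρ]; exact one_ne_zero)
  rw [hfg, map_zero, h2, zero_mul, add_zero, eq_comm, hu.mul_right_eq_zero, map_sub,
    sub_eq_zero] at h1
  exact h1

theorem IsBasePoint.eq_of_coordinates (hq : IsBasePoint q x) {X : Fin n → SmoothRing n M}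
    {g : SmoothRing n M} {G : Fin n → SmoothRing n M}
    (hG : ∀ᶠ y in 𝓝 x, g y = g x + ∑ i, (X i y - X i x) * G i y) :
    q g = algebraMap ℝ A (g x) + ∑ i, (q (X i) - algebraMap ℝ A (X i x)) * q (G i) := by
  have h1 : q g = q (algebraMap ℝ _ (g x) + ∑ i, (X i - algebraMap ℝ _ (X i x)) * G i) := by
    refine hq.apply_eq_of_eventuallyEq (hG.mono fun y hy => ?_)
    rw [hy, SmoothRing.add_sum_mul_apply]
  rw [h1]
  simp

/-- A derivation along an `A`-point is determined by its values on local coordinates. -/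
theorem IsBasePoint.derivation_eq_zero (hq : IsBasePoint q x) {X : Fin n → SmoothRing n M}
    (hX : ∀ g : SmoothRing n M, ∃ G : Fin n → SmoothRing n M,
      ∀ᶠ y in 𝓝 x, g y = g x + ∑ i, (X i y - X i x) * G i y)
    {d : SmoothRing n M →ₗ[ℝ] A} (hd : ∀ f g, d (f * g) = q f * d g + q g * d f)
    (hdX : ∀ i, d (X i) = 0) : d = 0 := by
  have hd1 : d 1 = 0 := by
    have := hd 1 1
    simpa using this
  have hdc : ∀ c : ℝ, d (algebraMap ℝ _ c) = 0 := fun c => by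
    rw [Algebra.algebraMap_eq_smul_one, map_smul, hd1, smul_zero]
  have key : ∀ k, ∀ f, d f ∈ IsLocalRing.maximalIdeal A ^ k := by
    intro k
    induction k with
    | zero => simp
    | succ k ih =>
      intro f
      obtain ⟨G, hG⟩ := hX f
      have h1 : d f = d (algebraMap ℝ _ (f x) + ∑ i, (X i - algebraMap ℝ _ (X i x)) * G i) := by
        refine hq.derivation_apply_eq_of_eventuallyEq hd (hG.mono fun y hy => ?_)
        rw [hy, SmoothRing.add_sum_mul_apply]
      rw [h1, map_add, hdc, zero_add, map_sum]
      refine sum_mem fun i _ => ?_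
      rw [hd, map_sub d, hdX, hdc, sub_zero, mul_zero, add_zero, pow_succ', map_sub]
      refine Ideal.mul_mem_mul ?_ (ih _)
      simpa using hq.sub_mem (X i)
  obtain ⟨N, hN⟩ := exists_maximalIdeal_pow_eq_bot A
  ext f
  simpa [hN] using key N f

variable (A) in
/-- Near every point, the regular `A`-points map a suitable finite set of functions onto a spanning
set of `A`, namely the monomials of bounded degree in local coordinates. -/
theorem exists_spanning_functions (x : M) : ∃ (L : ℕ) (g : Fin L → SmoothRing n M)
    (ρ : SmoothRing n M), ρ x = 1 ∧ ∀ (q : SmoothRing n M →ₐ[ℝ] A), Function.Surjective q →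
      weilAugmentation A (q ρ) ≠ 0 → Submodule.span ℝ (Set.range fun j => q (g j)) = ⊤ := by
  obtain ⟨X, ρ, hρ, hX, -⟩ := exists_coordinates (n := n) x
  obtain ⟨N, hN⟩ := exists_maximalIdeal_pow_eq_bot A
  let S : Submodule ℝ (SmoothRing n M) := Submodule.span ℝ ({1} ∪ Set.range X)
  have hfg : (S ^ N).FG := Submodule.FG.pow
    (Submodule.fg_span ((Set.finite_singleton 1).union (Set.finite_range X))) N
  obtain ⟨L, g, hg⟩ := Submodule.fg_iff_exists_fin_generating_family.1 hfg
  refine ⟨L, g, ρ, hρ, fun q hqs hqρ => ?_⟩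
  obtain ⟨x', hx'⟩ := exists_isBasePoint q
  have h1S : (1 : SmoothRing n M) ∈ S := Submodule.subset_span (Or.inl rfl)
  have htop : (S.map q.toLinearMap) ^ N = ⊤ := by
    refine Submodule.pow_eq_top_of_generators hN (Submodule.one_le.2 ⟨1, h1S, map_one q⟩)
      (a := fun i => q (X i) - algebraMap ℝ A (X i x')) (fun i => ?_) (fun i => hx'.sub_mem _) ?_
    · refine ⟨X i - algebraMap ℝ _ (X i x'), sub_mem (Submodule.subset_span (Or.inr ⟨i, rfl⟩)) ?_,
        ?_⟩
      · rw [Algebra.algebraMap_eq_smul_one]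
        exact Submodule.smul_mem _ _ h1S
      · simp
    · intro b
      obtain ⟨f, rfl⟩ := hqs b
      obtain ⟨G, hG⟩ := hX x' (by rwa [← hx' ρ]) f
      exact ⟨f x', fun i => q (G i), hx'.eq_of_coordinates hG⟩
  rw [← Submodule.map_pow, ← hg, Submodule.map_span, ← Set.range_comp] at htop
  exact htop

end BasePoint

/-! ### Curves of regular points -/

section WeakDerivative

variable {A : Type*} [CommRing A] [Algebra ℝ A]

/-- `a` is the derivative at `0` of the curve `c` in the vector space `A`, tested on linear forms.
-/
def HasWeakDeriv (c : ℝ → A) (a : A) : Prop :=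
  ∀ w : Module.Dual ℝ A, HasDerivAt (fun t => w (c t)) (w a) 0

theorem HasWeakDeriv.congr {c c' : ℝ → A} {a : A} (h : HasWeakDeriv c a)
    (hc : ∀ᶠ t in 𝓝 0, c' t = c t) : HasWeakDeriv c' a := fun w =>
  (h w).congr_of_eventuallyEq (hc.mono fun _ ht => congrArg w ht)

theorem eventually_span_eq_top {α : Type*} {l : Filter α} {ι : Type*} [Fintype ι] [DecidableEq ι]
    (b : Module.Basis ι ℝ A) {v : α → ι → A}
    (hv : ∀ i (w : Module.Dual ℝ A), Filter.Tendsto (fun t => w (v t i)) l (𝓝 (w (b i)))) :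
    ∀ᶠ t in l, Submodule.span ℝ (Set.range (v t)) = ⊤ := by
  have h1 : Filter.Tendsto (fun t => b.toMatrix (v t)) l (𝓝 (b.toMatrix b)) :=
    tendsto_pi_nhds.2 fun i => tendsto_pi_nhds.2 fun j => hv j (b.coord i)
  have h2 : Filter.Tendsto (fun t => (b.toMatrix (v t)).det) l (𝓝 1) := by
    have h3 : Continuous fun m : Matrix ι ι ℝ => m.det := continuous_id.matrix_det
    have h4 := (h3.tendsto _).comp h1
    rwa [b.toMatrix_self, Matrix.det_one] at h4
  filter_upwards [h2.eventually_ne one_ne_zero] with t ht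
  exact ((Module.Basis.is_basis_iff_det b).2 (isUnit_iff_ne_zero.2 ht)).2

variable [Module.Finite ℝ A]

theorem HasWeakDeriv.unique {c : ℝ → A} {a a' : A} (h : HasWeakDeriv c a)
    (h' : HasWeakDeriv c a') : a = a' :=
  (Module.finBasis ℝ A).ext_elem fun i =>
    (h ((Module.finBasis ℝ A).coord i)).unique (h' ((Module.finBasis ℝ A).coord i))

theorem exists_hasWeakDeriv {c : ℝ → A}
    (hc : ∀ w : Module.Dual ℝ A, DifferentiableAt ℝ (fun t => w (c t)) 0) :
    ∃ a, HasWeakDeriv c a := by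
  let b := Module.finBasis ℝ A
  refine ⟨∑ i, deriv (fun t => b.coord i (c t)) 0 • b i, fun w => ?_⟩
  have h1 : ∀ t, w (c t) = ∑ i, b.coord i (c t) * w (b i) := fun t => by
    conv_lhs => rw [← b.sum_repr (c t), map_sum]
    simp only [map_smul, smul_eq_mul, Module.Basis.coord_apply]
  simp only [h1]
  have h2 := HasDerivAt.fun_sum fun i (_ : i ∈ Finset.univ) =>
    (hc (b.coord i)).hasDerivAt.mul_const (w (b i))
  convert! h2 using 1
  simp

theorem HasWeakDeriv.mul {c c' : ℝ → A} {a a' : A} (h : HasWeakDeriv c a)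
    (h' : HasWeakDeriv c' a') :
    HasWeakDeriv (fun t => c t * c' t) (c 0 * a' + c' 0 * a) := by
  intro w
  let b := Module.finBasis ℝ A
  have h1 : ∀ x y : A, w (x * y) = ∑ i, b.coord i x * (w ∘ₗ LinearMap.mulLeft ℝ (b i)) y := by
    intro x y
    conv_lhs => rw [← b.sum_repr x, Finset.sum_mul]
    simp
  have h2 := HasDerivAt.fun_sum fun i (_ : i ∈ Finset.univ) =>
    (h (b.coord i)).fun_mul (h' (w ∘ₗ LinearMap.mulLeft ℝ (b i)))
  rw [Finset.sum_add_distrib, ← h1, ← h1, add_comm, mul_comm a] at h2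
  simp only [← h1] at h2
  rw [map_add]
  exact h2

end WeakDerivative

section Curves

variable {n : ℕ} {M : Type*} [TopologicalSpace M] [ChartedSpace (EuclideanSpace ℝ (Fin n)) M]
  {A : Type*} [CommRing A] [Algebra ℝ A]

/-- The velocity of a differentiable curve of regular points is a tangent vector. -/
theorem exists_tangent_of_curve {q : RegularPoint n M A} {c : ℝ → RegularPoint n M A}
    (hc0 : c 0 = q)
    {d : SmoothRing n M → A} (hd : ∀ f, HasWeakDeriv (fun t => (c t).1 f) (d f)) :
    ∃ v : tangentSpaceAt (smoothOnRegularPoints n M A) q,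
      (∀ f w, v.1 ⟨realComponent f w, realComponent_smooth f w⟩ = w (d f)) ∧
      ∀ F : smoothOnRegularPoints n M A, HasDerivAt (fun t => F.1 (c t)) (v.1 F) 0 := by
  have hcont : Filter.Tendsto c (𝓝 0) (𝓝 q) :=
    tendsto_nhds_regularPoint.2 fun f w => by
      have := (hd f w).continuousAt.tendsto
      dsimp only at this
      rwa [hc0] at this
  have hdiff : ∀ F : smoothOnRegularPoints n M A, DifferentiableAt ℝ (fun t => F.1 (c t)) 0 := by
    intro F
    obtain ⟨k, f, w, h, hh, hF⟩ := F.2 q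
    have h1 : DifferentiableAt ℝ (fun t i => realComponent (f i) (w i) (c t)) 0 :=
      differentiableAt_pi.2 fun i => (hd (f i) (w i)).differentiableAt
    exact ((hh.differentiable (by simp) _).comp (0 : ℝ) h1).congr_of_eventuallyEq
      (hcont.eventually hF)
  refine ⟨⟨⟨⟨fun F => deriv (fun t => F.1 (c t)) 0, fun F G => ?_⟩, fun r F => ?_⟩, fun F G => ?_⟩,
    fun f w => (hd f w).deriv, fun F => (hdiff F).hasDerivAt⟩
  · exact deriv_add (hdiff F) (hdiff G)
  · exact deriv_const_mul r (hdiff F)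
  · have := deriv_mul (hdiff F) (hdiff G)
    rw [hc0] at this
    refine Eq.trans this ?_
    change _ = F.1 q * deriv (fun t => G.1 (c t)) 0 + G.1 q * deriv (fun t => F.1 (c t)) 0
    ring

variable [IsWeilAlgebra A]

/-- An `A`-point of Euclidean space maps smooth families of functions to smooth curves, by repeated
use of Hadamard's lemma and nilpotency of the maximal ideal. -/
theorem contDiff_apply_family {q : SmoothRing n (EuclideanSpace ℝ (Fin n)) →ₐ[ℝ] A}
    {y₀ : EuclideanSpace ℝ (Fin n)} (hq : IsBasePoint q y₀) (w : Module.Dual ℝ A)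
    {F : ℝ × EuclideanSpace ℝ (Fin n) → ℝ} (hF : ContDiff ℝ ∞ F)
    {f : ℝ → SmoothRing n (EuclideanSpace ℝ (Fin n))} (hf : ∀ t y, f t y = F (t, y)) :
    ContDiff ℝ ∞ fun t => w (q (f t)) := by
  obtain ⟨N, hN⟩ := exists_maximalIdeal_pow_eq_bot A
  have key : ∀ k, ∀ b ∈ IsLocalRing.maximalIdeal A ^ (N - k),
      ∀ {F : ℝ × EuclideanSpace ℝ (Fin n) → ℝ}, ContDiff ℝ ∞ F →
      ∀ {f : ℝ → SmoothRing n (EuclideanSpace ℝ (Fin n))}, (∀ t y, f t y = F (t, y)) →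
      ContDiff ℝ ∞ fun t => w (b * q (f t)) := by
    intro k
    induction k with
    | zero =>
      intro b hb F hF f hf
      rw [Nat.sub_zero, hN, Ideal.mem_bot] at hb
      simp only [hb, zero_mul, map_zero]
      exact contDiff_const
    | succ k ih =>
      intro b hb F hF f hf
      obtain ⟨G, hG, hGF⟩ := hadamard_euclidean hF y₀
      let g : Fin n → ℝ → SmoothRing n (EuclideanSpace ℝ (Fin n)) := fun i t =>
        ⟨fun y => G i (t, y), ((hG i).comp (contDiff_prodMk_right t)).contMDiff⟩
      let X : Fin n → SmoothRing n (EuclideanSpace ℝ (Fin n)) := fun i =>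
        ⟨fun y => y i, (EuclideanSpace.proj i :
          EuclideanSpace ℝ (Fin n) →L[ℝ] ℝ).contDiff.contMDiff⟩
      have h1 : ∀ t, w (b * q (f t)) = F (t, y₀) * w b +
          ∑ i, w (b * (q (X i) - algebraMap ℝ A (y₀ i)) * q (g i t)) := by
        intro t
        have h2 := hq.eq_of_coordinates (X := X) (g := f t) (G := fun i => g i t)
          (Filter.Eventually.of_forall fun y => by
            rw [hf, hf]
            exact hGF t y)
        rw [h2, hf, mul_add, map_add, Finset.mul_sum, map_sum, mul_comm b, ← Algebra.smul_def,
          map_smul, smul_eq_mul]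
        congr 1
        exact Finset.sum_congr rfl fun i _ => by rw [mul_assoc]; rfl
      simp only [h1]
      refine ((hF.comp (contDiff_prodMk_left y₀)).mul contDiff_const).add
        (ContDiff.sum fun i _ => ih _ ?_ (hG i) fun t y => rfl)
      refine Ideal.pow_le_pow_right (show N - k ≤ N - (k + 1) + 1 by omega) ?_
      rw [pow_succ]
      exact Ideal.mul_mem_mul hb (hq.sub_mem (X i))
  simpa using key N 1 (by simp) hF hf

variable [IsManifold (𝓡 n) ∞ M] [T2Space M] [SecondCountableTopology M]

/-- An `A`-point of `M` comes from an `A`-point of Euclidean space through a chart. -/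
theorem IsBasePoint.exists_chart_point {q : SmoothRing n M →ₐ[ℝ] A} {x : M} (hq : IsBasePoint q x) :
    ∃ q' : SmoothRing n (EuclideanSpace ℝ (Fin n)) →ₐ[ℝ] A,
      IsBasePoint q' (chartAt (EuclideanSpace ℝ (Fin n)) x x) ∧
      ∀ (f : SmoothRing n M) (h : SmoothRing n (EuclideanSpace ℝ (Fin n))),
        (∀ᶠ y in 𝓝 x, f y = h (chartAt (EuclideanSpace ℝ (Fin n)) x y)) → q f = q' h := by
  choose p hp using fun h : SmoothRing n (EuclideanSpace ℝ (Fin n)) =>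
    exists_smoothRing_eventuallyEq_chartAt (n := n) (mem_chart_source (EuclideanSpace ℝ (Fin n)) x)
      h.contMDiff.contDiff
  have hloc : ∀ (f : SmoothRing n M) (h : SmoothRing n (EuclideanSpace ℝ (Fin n))),
      (∀ᶠ y in 𝓝 x, f y = h (chartAt (EuclideanSpace ℝ (Fin n)) x y)) → q f = q (p h) :=
    fun f h hf => hq.apply_eq_of_eventuallyEq (by
      filter_upwards [hf, hp h] with y h1 h2
      rw [h1, h2])
  refine ⟨{
    toFun := fun h => q (p h)
    map_one' := ?_
    map_mul' := fun h k => ?_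
    map_zero' := ?_
    map_add' := fun h k => ?_
    commutes' := fun r => ?_ }, fun h => ?_, hloc⟩
  · rw [← hloc 1 1 (Filter.Eventually.of_forall fun _ => rfl), map_one]
  · rw [← map_mul]
    exact (hloc (p h * p k) (h * k) (by
      filter_upwards [hp h, hp k] with y h1 h2
      change p h y * p k y = h _ * k _
      rw [h1, h2])).symm
  · rw [← hloc 0 0 (Filter.Eventually.of_forall fun _ => rfl), map_zero]
  · rw [← map_add]
    exact (hloc (p h + p k) (h + k) (by
      filter_upwards [hp h, hp k] with y h1 h2
      change p h y + p k y = h _ + k _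
      rw [h1, h2])).symm
  · rw [← hloc (algebraMap ℝ _ r) (algebraMap ℝ _ r) (Filter.Eventually.of_forall fun _ => rfl),
      AlgHom.commutes]
  · exact (hq (p h)).trans (hp h).self_of_nhds

/-- Every derivation along a regular point `q` is the velocity of a curve of regular points. The
curve is obtained, in a chart, by composing `q` with the maps `y ↦ y + t g(y)`, where `g` is a
vector field that represents the derivation. -/
theorem exists_tangent_of_derivation (q : RegularPoint n M A) {d : SmoothRing n M →ₗ[ℝ] A}
    (hd : ∀ f g, d (f * g) = q.1 f * d g + q.1 g * d f) :
    ∃ v : tangentSpaceAt (smoothOnRegularPoints n M A) q,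
      ∀ f w, v.1 ⟨realComponent f w, realComponent_smooth f w⟩ = w (d f) := by
  classical
  obtain ⟨x, hx⟩ := exists_isBasePoint q.1
  obtain ⟨q', hq', hqq'⟩ := hx.exists_chart_point
  obtain ⟨X, ρ, hρ, hX, hXφ⟩ := exists_coordinates (n := n) x
  set φ := chartAt (EuclideanSpace ℝ (Fin n)) x
  have hxs : x ∈ φ.source := mem_chart_source _ x
  have hφ : ContinuousAt φ x := φ.continuousAt hxs
  obtain ⟨B, hB, hB1, hBt⟩ := exists_contDiff_bump (φ.open_target.mem_nhds (φ.map_source hxs))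
  let hat : SmoothRing n M → EuclideanSpace ℝ (Fin n) → ℝ := fun f y => B y * f (φ.symm y)
  have hhat : ∀ f, ContDiff ℝ ∞ (hat f) := contDiff_cutoff_comp_symm hB hBt
  have hqhat : ∀ f (h : SmoothRing n (EuclideanSpace ℝ (Fin n))),
      (∀ᶠ y in 𝓝 (φ x), h y = hat f y) → q.1 f = q' h := by
    intro f h hfh
    refine hqq' f h ?_
    filter_upwards [hφ.eventually hfh, hφ.eventually hB1, φ.open_source.mem_nhds hxs]
      with y h1 h2 h3
    rw [h1]
    simp only [hat]
    rw [h2, one_mul, φ.left_inv h3]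
  have hsurj : ∀ a, ∃ g : SmoothRing n (EuclideanSpace ℝ (Fin n)), q' g = a := by
    intro a
    obtain ⟨f, rfl⟩ := q.2 a
    exact ⟨⟨hat f, (hhat f).contMDiff⟩, (hqhat f _ (Filter.Eventually.of_forall fun _ => rfl)).symm⟩
  choose g hg using fun i => hsurj (d (X i))
  -- the flow to first order of a vector field which realizes the derivation in the chart
  let Φ : ℝ × EuclideanSpace ℝ (Fin n) → EuclideanSpace ℝ (Fin n) := fun p =>
    p.2 + p.1 • ∑ i, g i p.2 • EuclideanSpace.single i (1 : ℝ)
  have hΦ : ContDiff ℝ ∞ Φ := by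
    refine contDiff_snd.add (contDiff_fst.smul (ContDiff.sum fun i _ => ?_))
    exact ((g i).contMDiff.contDiff.comp contDiff_snd).smul contDiff_const
  have hΦ0 : ∀ y, Φ (0, y) = y := fun y => by simp [Φ]
  have hF : ∀ f, ContDiff ℝ ∞ fun p => hat f (Φ p) := fun f => (hhat f).comp hΦ
  let F : SmoothRing n M → ℝ → SmoothRing n (EuclideanSpace ℝ (Fin n)) := fun f t =>
    ⟨fun y => hat f (Φ (t, y)), ((hF f).comp (contDiff_prodMk_right t)).contMDiff⟩
  let c : ℝ → SmoothRing n M → A := fun t f => q' (F f t)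
  have hcdiff : ∀ f, ∃ a, HasWeakDeriv (fun t => c t f) a := fun f =>
    exists_hasWeakDeriv fun w =>
      (contDiff_apply_family hq' w (hF f) (f := F f) fun _ _ => rfl).differentiable (by simp) 0
  have hc0 : ∀ f, c 0 f = q.1 f := fun f =>
    (hqhat f _ (Filter.Eventually.of_forall fun y => congrArg (hat f) (hΦ0 y))).symm
  have hloc : ∀ {P : EuclideanSpace ℝ (Fin n) → Prop}, (∀ᶠ y in 𝓝 (φ x), P y) →
      ∀ᶠ t in 𝓝 (0 : ℝ), ∀ᶠ y in 𝓝 (φ x), P (Φ (t, y)) := by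
    intro P hP
    have h1 : ContinuousAt Φ (0, φ x) := hΦ.continuous.continuousAt
    have h2 : ∀ᶠ p in 𝓝 ((0 : ℝ), φ x), P (Φ p) := h1.eventually (by rwa [hΦ0])
    rw [nhds_prod_eq] at h2
    exact h2.curry
  have hev : ∀ᶠ t in 𝓝 (0 : ℝ), ∀ᶠ y in 𝓝 (φ x), B (Φ (t, y)) = 1 := hloc hB1
  have hcadd : ∀ t f f', c t (f + f') = c t f + c t f' := fun t f f' => by
    simp only [c, ← map_add]
    congr 1
    ext y
    exact mul_add _ _ _
  have hcsmul : ∀ t (r : ℝ) f, c t (r • f) = r • c t f := fun t r f => by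
    simp only [c, ← map_smul]
    congr 1
    ext y
    exact mul_left_comm _ _ _
  have hcone : ∀ᶠ t in 𝓝 (0 : ℝ), c t 1 = 1 := by
    filter_upwards [hev] with t ht
    rw [← map_one q']
    refine hq'.apply_eq_of_eventuallyEq (ht.mono fun y hy => ?_)
    change B _ * 1 = 1
    rw [hy, one_mul]
  have hcmul : ∀ᶠ t in 𝓝 (0 : ℝ), ∀ f f', c t (f * f') = c t f * c t f' := by
    filter_upwards [hev] with t ht f f'
    simp only [c, ← map_mul]
    refine hq'.apply_eq_of_eventuallyEq (ht.mono fun y hy => ?_)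
    change B _ * (f _ * f' _) = (B _ * f _) * (B _ * f' _)
    rw [hy]
    ring
  have hcspan : ∀ᶠ t in 𝓝 (0 : ℝ), Function.Surjective (c t) := by
    let b := Module.finBasis ℝ A
    choose s hs using fun i => q.2 (b i)
    have h1 := eventually_span_eq_top b (v := fun t i => c t (s i)) (l := 𝓝 0) fun i w => by
      obtain ⟨a, ha⟩ := hcdiff (s i)
      have := (ha w).continuousAt.tendsto
      dsimp only at this
      rwa [hc0, hs] at this
    filter_upwards [h1] with t ht
    let ct : SmoothRing n M →ₗ[ℝ] A := ⟨⟨c t, hcadd t⟩, hcsmul t⟩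
    have h2 : LinearMap.range ct = ⊤ := top_le_iff.1 (ht ▸ Submodule.span_le.2 ?_)
    · exact LinearMap.range_eq_top.1 h2
    rintro _ ⟨i, rfl⟩
    exact ⟨s i, rfl⟩
  have hq_t : ∀ᶠ t in 𝓝 (0 : ℝ), ∃ r : RegularPoint n M A, ∀ f, r.1 f = c t f := by
    filter_upwards [hcone, hcmul, hcspan] with t h1 h2 h3
    exact ⟨⟨AlgHom.ofLinearMap ⟨⟨c t, hcadd t⟩, hcsmul t⟩ h1 h2, h3⟩, fun f => rfl⟩
  -- the maps `c t` are regular points for small `t`; elsewhere `Q t` takes the value `q`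
  let Q : ℝ → RegularPoint n M A := fun t =>
    if h : ∃ r : RegularPoint n M A, ∀ f, r.1 f = c t f then h.choose else q
  have hQ : ∀ᶠ t in 𝓝 (0 : ℝ), ∀ f, (Q t).1 f = c t f := by
    filter_upwards [hq_t] with t ht f
    simp only [Q, dif_pos ht]
    exact ht.choose_spec f
  have hQ0 : Q 0 = q := Subtype.ext (AlgHom.ext fun f => by rw [hQ.self_of_nhds, hc0])
  choose d' hd' using hcdiff
  let D' : SmoothRing n M →ₗ[ℝ] A :=
    ⟨⟨d', fun f f' => (hd' (f + f')).unique fun w => by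
      simp only [hcadd, map_add]
      exact (hd' f w).add (hd' f' w)⟩, fun r f => (hd' (r • f)).unique fun w => by
      simp only [hcsmul, map_smul]
      exact (hd' f w).const_mul r⟩
  have hD'mul : ∀ f f', D' (f * f') = q.1 f * D' f' + q.1 f' * D' f := fun f f' => by
    rw [← hc0, ← hc0]
    refine (hd' (f * f')).unique (((hd' f).mul (hd' f')).congr ?_)
    filter_upwards [hcmul] with t ht
    exact ht f f'
  have hD'X : ∀ i, D' (X i) = d (X i) := by
    intro i
    have hhatX : ∀ᶠ y in 𝓝 (φ x), hat (X i) y = y i := by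
      have h1 : ContinuousAt φ.symm (φ x) := φ.symm.continuousAt (φ.map_source hxs)
      have h2 := h1.eventually (p := fun z => X i z = φ z i) (by
        rw [φ.left_inv hxs]
        exact hXφ i)
      filter_upwards [hB1, h2, φ.open_target.mem_nhds (φ.map_source hxs)] with y h3 h4 h5
      simp only [hat]
      rw [h3, h4, one_mul, φ.right_inv h5]
    let Y : SmoothRing n (EuclideanSpace ℝ (Fin n)) := ⟨fun y => y i, (EuclideanSpace.proj i :
      EuclideanSpace ℝ (Fin n) →L[ℝ] ℝ).contDiff.contMDiff⟩
    have hcX : ∀ᶠ t in 𝓝 (0 : ℝ), c t (X i) = q' Y + t • d (X i) := by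
      filter_upwards [hloc hhatX] with t ht
      rw [← hg i, ← map_smul, ← map_add]
      refine hq'.apply_eq_of_eventuallyEq (ht.mono fun y hy => ?_)
      refine hy.trans ?_
      change Φ (t, y) i = y i + t * g i y
      simp [Φ, Pi.single_apply]
    refine (hd' (X i)).unique (HasWeakDeriv.congr (c := fun t => q' Y + t • d (X i)) ?_ hcX)
    intro w
    simp only [map_add, map_smul, smul_eq_mul]
    simpa using ((hasDerivAt_id (0 : ℝ)).mul_const (w (d (X i)))).const_add (w (q' Y))
  have hDD' : D' - d = 0 := by
    refine hx.derivation_eq_zero (hX x (by rw [hρ]; exact one_ne_zero)) (fun f f' => ?_) fun i => ?_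
    · simp only [LinearMap.sub_apply, hd, hD'mul]
      ring
    · rw [LinearMap.sub_apply, hD'X, sub_self]
  obtain ⟨v, hv, -⟩ := exists_tangent_of_curve hQ0 (d := d) fun f => by
    have h1 : d f = d' f :=
      (sub_eq_zero.1 (congrArg (fun g : SmoothRing n M →ₗ[ℝ] A => g f) hDD')).symm
    rw [h1]
    exact (hd' f).congr (hQ.mono fun t ht => ht f)
  exact ⟨v, hv⟩

end Curves

/-! ### Automorphisms acting on regular points -/

section Automorphisms

variable {n : ℕ} {M : Type*} [TopologicalSpace M] [ChartedSpace (EuclideanSpace ℝ (Fin n)) M]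
  {A : Type*} [CommRing A] [Algebra ℝ A]

/-- The action of the automorphisms of `A` on the regular `A`-points, by composition. -/
def RegularPoint.map (τ : A ≃ₐ[ℝ] A) (q : RegularPoint n M A) : RegularPoint n M A :=
  ⟨(τ : A →ₐ[ℝ] A).comp q.1, τ.surjective.comp q.2⟩

theorem RegularPoint.map_apply (τ : A ≃ₐ[ℝ] A) (q : RegularPoint n M A) (f : SmoothRing n M) :
    (q.map τ).1 f = τ (q.1 f) := rfl

theorem RegularPoint.jet_map (τ : A ≃ₐ[ℝ] A) (q : RegularPoint n M A) : (q.map τ).jet = q.jet := by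
  refine Subtype.ext (Ideal.ext fun f => ?_)
  change τ (q.1 f) = 0 ↔ q.1 f = 0
  exact map_eq_zero_iff τ τ.injective

theorem RegularPoint.exists_map_eq_of_jet_eq {q q' : RegularPoint n M A} (h : q'.jet = q.jet) :
    ∃ τ : A ≃ₐ[ℝ] A, q' = q.map τ := by
  have hker : RingHom.ker q.1 = RingHom.ker q'.1 := (congrArg Subtype.val h).symm
  refine ⟨((Ideal.quotientKerAlgEquivOfSurjective q.2).symm.trans
    (Ideal.quotientEquivAlgOfEq ℝ hker)).trans (Ideal.quotientKerAlgEquivOfSurjective q'.2), ?_⟩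
  refine Subtype.ext (AlgHom.ext fun f => ?_)
  rw [RegularPoint.map_apply]
  have h1 : (Ideal.quotientKerAlgEquivOfSurjective q.2).symm (q.1 f) =
      Ideal.Quotient.mk (RingHom.ker q.1) f := by
    rw [AlgEquiv.symm_apply_eq]
    rfl
  simp only [AlgEquiv.trans_apply, h1]
  rfl

theorem RegularPoint.exists_jet_eq (𝔭 : JetOfType n M A) : ∃ q : RegularPoint n M A, q.jet = 𝔭 := by
  obtain ⟨e⟩ := 𝔭.2
  refine ⟨⟨(e : (SmoothRing n M ⧸ 𝔭.1) →ₐ[ℝ] A).comp (Ideal.Quotient.mkₐ ℝ 𝔭.1),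
    e.surjective.comp (Ideal.Quotient.mkₐ_surjective ℝ 𝔭.1)⟩, Subtype.ext (Ideal.ext fun f => ?_)⟩
  change e (Ideal.Quotient.mk 𝔭.1 f) = 0 ↔ f ∈ 𝔭.1
  rw [map_eq_zero_iff e e.injective, Ideal.Quotient.eq_zero_iff_mem]

/-- An invariant smooth function on the regular points descends to a smooth function of jets. -/
theorem exists_smoothOnJets {G : RegularPoint n M A → ℝ} (hG : G ∈ smoothOnRegularPoints n M A)
    (hinv : ∀ (τ : A ≃ₐ[ℝ] A) q, G (q.map τ) = G q) :
    ∃ F : smoothOnJets n M A, ∀ q : RegularPoint n M A, F.1 q.jet = G q := by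
  choose s hs using RegularPoint.exists_jet_eq (n := n) (M := M) (A := A)
  have h1 : ∀ q : RegularPoint n M A, G (s q.jet) = G q := fun q => by
    obtain ⟨τ, hτ⟩ := RegularPoint.exists_map_eq_of_jet_eq (hs q.jet)
    rw [hτ, hinv]
  refine ⟨⟨fun 𝔭 => G (s 𝔭), ?_⟩, h1⟩
  change (fun q : RegularPoint n M A => G (s q.jet)) ∈ smoothOnRegularPoints n M A
  simpa only [h1] using hG

/-- A tangent vector at a regular point is determined by its values on the real components. -/
theorem tangentSpaceAt.ext_realComponent {q : RegularPoint n M A}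
    {v v' : tangentSpaceAt (smoothOnRegularPoints n M A) q}
    (h : ∀ f w, v.1 ⟨realComponent f w, realComponent_smooth f w⟩ =
      v'.1 ⟨realComponent f w, realComponent_smooth f w⟩) : v = v' := by
  refine Subtype.ext (LinearMap.ext fun F => ?_)
  obtain ⟨k, f, w, g, hg, hF⟩ := F.2 q
  rw [tangentSpaceAt.chain_rule_realComponent v hg hF,
    tangentSpaceAt.chain_rule_realComponent v' hg hF]
  simp only [h]

end Automorphisms

section WeilProduct

variable (A : Type*) [CommRing A] [Algebra ℝ A] [Module.Finite ℝ A]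

/-- Coordinates on the vector space `A`. -/
def weilCoord : A ≃ₗ[ℝ] (Fin (Module.finrank ℝ A) → ℝ) := (Module.finBasis ℝ A).equivFun

/-- The product of `A` in coordinates, as a continuous bilinear map. -/
def weilProduct : (Fin (Module.finrank ℝ A) → ℝ) →L[ℝ] (Fin (Module.finrank ℝ A) → ℝ) →L[ℝ]
    (Fin (Module.finrank ℝ A) → ℝ) :=
  LinearMap.toContinuousLinearMap ((LinearMap.toContinuousLinearMap (𝕜 := ℝ)
    (E := Fin (Module.finrank ℝ A) → ℝ) (F' := Fin (Module.finrank ℝ A) → ℝ)).toLinearMap ∘ₗ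
      (((LinearMap.mul ℝ A).compl₁₂ (weilCoord A).symm.toLinearMap
        (weilCoord A).symm.toLinearMap).compr₂ (weilCoord A).toLinearMap))

variable {A}

theorem weilProduct_apply (x y : Fin (Module.finrank ℝ A) → ℝ) :
    weilProduct A x y = weilCoord A ((weilCoord A).symm x * (weilCoord A).symm y) := rfl

theorem isBilinAut_weilProduct_algEquiv (τ : A ≃ₐ[ℝ] A) :
    IsBilinAut (weilProduct A) (LinearMap.toContinuousLinearMap
      ((weilCoord A).toLinearMap ∘ₗ τ.toLinearMap ∘ₗ (weilCoord A).symm.toLinearMap)) := by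
  refine ⟨ContinuousLinearMap.isUnit_of_surjective ?_, fun x y => ?_⟩
  · exact (weilCoord A).surjective.comp (τ.surjective.comp (weilCoord A).symm.surjective)
  · simp [weilProduct_apply]

theorem IsBilinAut.exists_algEquiv {h : (Fin (Module.finrank ℝ A) → ℝ) →L[ℝ]
    (Fin (Module.finrank ℝ A) → ℝ)} (hh : IsBilinAut (weilProduct A) h) :
    ∃ τ : A ≃ₐ[ℝ] A, ∀ a, weilCoord A (τ a) = h (weilCoord A a) := by
  let l : A →ₗ[ℝ] A := (weilCoord A).symm.toLinearMap ∘ₗ h.toLinearMap ∘ₗ (weilCoord A).toLinearMap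
  have hl : ∀ a, weilCoord A (l a) = h (weilCoord A a) := fun a => by simp [l]
  have hmul : ∀ a b, l (a * b) = l a * l b := fun a b => (weilCoord A).injective (by
    have := hh.2 (weilCoord A a) (weilCoord A b)
    simp only [weilProduct_apply, LinearEquiv.symm_apply_apply, ← hl] at this
    exact this)
  have hbij : Function.Bijective l := by
    have h1 : Function.Surjective h := fun x => ⟨Ring.inverse h x, hh.1.apply_ringInverse_apply x⟩
    have h2 : Function.Surjective l :=
      (weilCoord A).symm.surjective.comp (h1.comp (weilCoord A).surjective)
    exact ⟨LinearMap.injective_iff_surjective.2 h2, h2⟩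
  have hone : l 1 = 1 := by
    obtain ⟨a, ha⟩ := hbij.2 1
    calc l 1 = l 1 * l a := by rw [ha, mul_one]
      _ = l (1 * a) := (hmul 1 a).symm
      _ = 1 := by rw [one_mul, ha]
  exact ⟨AlgEquiv.ofBijective (AlgHom.ofLinearMap l hone hmul) hbij, hl⟩

end WeilProduct

section Vertical

variable {n : ℕ} {M : Type*} [TopologicalSpace M] [ChartedSpace (EuclideanSpace ℝ (Fin n)) M]
  {A : Type*} [CommRing A] [Algebra ℝ A] [Module.Finite ℝ A]

/-- The tangent vector given by a derivation `δ` of `A` is the velocity of the curve `exp (t δ) ∘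
q`, which lies in the orbit of `q`; it kills the functions which are constant along the orbits. -/
theorem tangentSpaceAt.apply_eq_zero_of_vertical {q : RegularPoint n M A}
    (v : tangentSpaceAt (smoothOnRegularPoints n M A) q) {δ : A →ₗ[ℝ] A}
    (hδ : ∀ a b, δ (a * b) = a * δ b + b * δ a)
    (hv : ∀ f w, v.1 ⟨realComponent f w, realComponent_smooth f w⟩ = w (δ (q.1 f)))
    (F : smoothOnRegularPoints n M A) (hF : ∀ (τ : A ≃ₐ[ℝ] A) q', F.1 (q'.map τ) = F.1 q') :
    v.1 F = 0 := by
  let δ' : (Fin (Module.finrank ℝ A) → ℝ) →L[ℝ] (Fin (Module.finrank ℝ A) → ℝ) :=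
    LinearMap.toContinuousLinearMap
      ((weilCoord A).toLinearMap ∘ₗ δ ∘ₗ (weilCoord A).symm.toLinearMap)
  have hδ' : δ' ∈ bilinDer (weilProduct A) := by
    intro x y
    have h1 : ∀ z, δ' z = weilCoord A (δ ((weilCoord A).symm z)) := fun _ => rfl
    simp only [weilProduct_apply, h1, LinearEquiv.symm_apply_apply, hδ, map_add]
    rw [add_comm, mul_comm ((weilCoord A).symm y)]
  choose τ hτ using fun t : ℝ => (isBilinAut_exp (Submodule.smul_mem _ t hδ')).exists_algEquiv
  have hτ0 : q.map (τ 0) = q := by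
    refine Subtype.ext (AlgHom.ext fun f => (weilCoord A).injective ?_)
    rw [RegularPoint.map_apply, hτ, zero_smul, NormedSpace.exp_zero]
    rfl
  obtain ⟨v', hv', hv'F⟩ := exists_tangent_of_curve (c := fun t => q.map (τ t)) hτ0
    (d := fun f => δ (q.1 f)) fun f w => by
    let wc : (Fin (Module.finrank ℝ A) → ℝ) →L[ℝ] ℝ :=
      LinearMap.toContinuousLinearMap (w ∘ₗ (weilCoord A).symm.toLinearMap)
    have h1 : ∀ a, w a = wc (weilCoord A a) := fun a =>
      congrArg w ((weilCoord A).symm_apply_apply a).symm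
    simp only [h1, RegularPoint.map_apply, hτ]
    have h2 := hasDerivAt_exp_smul_const' (𝕂 := ℝ) δ' (0 : ℝ)
    have h3 := wc.hasFDerivAt.comp_hasDerivAt (0 : ℝ)
      (h2.clm_apply (hasDerivAt_const 0 (weilCoord A (q.1 f))))
    convert! h3 using 1
    simp only [zero_smul, NormedSpace.exp_zero, mul_one, map_zero, add_zero]
    exact congrArg (fun a => wc (weilCoord A (δ a))) ((weilCoord A).symm_apply_apply _).symm
  have hvv' : v = v' := tangentSpaceAt.ext_realComponent fun f w => by rw [hv, hv']
  have h4 := hv'F F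
  simp only [hF] at h4
  rw [hvv']
  exact h4.unique (hasDerivAt_const 0 _)

end Vertical

/-! ### Normalization of regular points along the orbits of the automorphisms -/

section Normalization

/-- Surjectivity is an open condition, since a right inverse of `T₀` is nearly a right inverse of
`T`. -/
theorem ContinuousLinearMap.eventually_surjective {V W : Type*} [NormedAddCommGroup V]
    [NormedSpace ℝ V] [FiniteDimensional ℝ V] [NormedAddCommGroup W] [NormedSpace ℝ W]
    {T₀ : W →L[ℝ] V} (hT₀ : Function.Surjective T₀) :
    ∀ᶠ T : W →L[ℝ] V in 𝓝 T₀, Function.Surjective T := by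
  have : CompleteSpace V := FiniteDimensional.complete ℝ V
  obtain ⟨R', hR'⟩ := T₀.toLinearMap.exists_rightInverse_of_surjective
    (LinearMap.range_eq_top.2 hT₀)
  let R : V →L[ℝ] W := LinearMap.toContinuousLinearMap R'
  have hR : T₀.comp R = 1 := by
    ext x
    exact congrArg (fun f : V →ₗ[ℝ] V => f x) hR'
  have hcomp : Continuous fun T : W →L[ℝ] V => T.comp R := by fun_prop
  have hone : ∀ᶠ Q : V →L[ℝ] V in 𝓝 1, IsUnit Q := Units.nhds (1 : (V →L[ℝ] V)ˣ)
  have hunit : ∀ᶠ T : W →L[ℝ] V in 𝓝 T₀, IsUnit (T.comp R) :=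
    (hcomp.tendsto' T₀ 1 hR).eventually hone
  filter_upwards [hunit] with T hT x
  exact ⟨R (Ring.inverse (T.comp R) x), hT.apply_ringInverse_apply x⟩

variable {n : ℕ} {M : Type*} [TopologicalSpace M] [ChartedSpace (EuclideanSpace ℝ (Fin n)) M]
  {A : Type*} [CommRing A] [Algebra ℝ A]

/-- The linear map `ℝ^L → A` (in coordinates) with values `q (g j)` on the standard basis. -/
def frameMap [Module.Finite ℝ A] {L : ℕ} (g : Fin L → SmoothRing n M)
    (q : SmoothRing n M →ₐ[ℝ] A) :
    (Fin L → ℝ) →L[ℝ] (Fin (Module.finrank ℝ A) → ℝ) :=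
  LinearMap.toContinuousLinearMap
    ((weilCoord A).toLinearMap ∘ₗ Fintype.linearCombination ℝ fun j => q (g j))

theorem frameMap_surjective [Module.Finite ℝ A] {L : ℕ} {g : Fin L → SmoothRing n M}
    {q : SmoothRing n M →ₐ[ℝ] A} (h : Submodule.span ℝ (Set.range fun j => q (g j)) = ⊤) :
    Function.Surjective (frameMap g q) := by
  rw [← Fintype.range_linearCombination ℝ] at h
  exact (weilCoord A).surjective.comp (LinearMap.range_eq_top.1 h)

/-- A linear map assembled from its matrix coefficients. -/
def matrixMap (d L : ℕ) : (Fin d × Fin L → ℝ) →L[ℝ] (Fin L → ℝ) →L[ℝ] (Fin d → ℝ) :=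
  LinearMap.toContinuousLinearMap ((LinearMap.toContinuousLinearMap (𝕜 := ℝ)
    (E := Fin L → ℝ) (F' := Fin d → ℝ)).toLinearMap ∘ₗ
      (Matrix.toLin' (R := ℝ) (m := Fin d) (n := Fin L)).toLinearMap ∘ₗ
        (LinearEquiv.curry ℝ ℝ (Fin d) (Fin L)).toLinearMap)

theorem matrixMap_realComponent [Module.Finite ℝ A] {L : ℕ} (g : Fin L → SmoothRing n M)
    (q : RegularPoint n M A) :
    matrixMap (Module.finrank ℝ A) L (fun p => realComponent (g p.2)
      (LinearMap.proj p.1 ∘ₗ (weilCoord A).toLinearMap) q) = frameMap g q.1 := by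
  ext x i
  change Matrix.toLin' (Matrix.of fun i j => weilCoord A (q.1 (g j)) i) x i =
    weilCoord A (∑ j, x j • q.1 (g j)) i
  simp [Matrix.mulVec, dotProduct, mul_comm]

variable [IsWeilAlgebra A]

theorem weilAugmentation_algEquiv (τ : A ≃ₐ[ℝ] A) (a : A) :
    weilAugmentation A (τ a) = weilAugmentation A a := by
  have h1 : τ (a - algebraMap ℝ A (weilAugmentation A a)) ∈ IsLocalRing.maximalIdeal A := by
    rw [IsLocalRing.mem_maximalIdeal, mem_nonunits_iff, MulEquiv.isUnit_map τ]
    exact (IsLocalRing.mem_maximalIdeal _).1 (sub_algebraMap_weilAugmentation_mem a)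
  rw [← weilAugmentation_eq_zero_iff] at h1
  simpa [sub_eq_zero] using h1

/-- A smooth function of the frame map, which only makes sense where the frame map is surjective,
becomes a smooth function of all regular points after multiplication by a cutoff function, which
vanishes when the residue of `q ρ` is at most `1 / 2` and is `1` when the residue is at least
`3 / 4`. -/
theorem frameMap_smooth {L : ℕ} {g : Fin L → SmoothRing n M} {ρ : SmoothRing n M}
    (hg : ∀ (q : SmoothRing n M →ₐ[ℝ] A), Function.Surjective q → weilAugmentation A (q ρ) ≠ 0 →
      Submodule.span ℝ (Set.range fun j => q (g j)) = ⊤)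
    {ψ : ((Fin L → ℝ) →L[ℝ] (Fin (Module.finrank ℝ A) → ℝ)) → ℝ}
    (hψ : ∀ T : (Fin L → ℝ) →L[ℝ] (Fin (Module.finrank ℝ A) → ℝ), Function.Surjective T →
      ContDiffAt ℝ ∞ ψ T) :
    (fun q : RegularPoint n M A => Real.smoothTransition (4 * weilAugmentation A (q.1 ρ) - 2) *
      ψ (frameMap g q.1)) ∈ smoothOnRegularPoints n M A := by
  intro q
  have haug : realComponent ρ (weilAugmentation A).toLinearMap ∈ smoothOnRegularPoints n M A :=
    realComponent_smooth _ _
  have hr : ∀ q' : RegularPoint n M A, realComponent ρ (weilAugmentation A).toLinearMap q' =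
    weilAugmentation A (q'.1 ρ) := fun _ => rfl
  by_cases h0 : weilAugmentation A (q.1 ρ) = 0
  · refine (SmoothAtRegularPoint.const 0 q).congr ?_
    have h1 := (continuous_realComponent ρ (weilAugmentation A).toLinearMap).continuousAt (x := q)
      |>.eventually_lt (continuousAt_const (y := (1 / 2 : ℝ))) (by rw [hr, h0]; norm_num)
    filter_upwards [h1] with q' hq'
    rw [hr] at hq'
    rw [Real.smoothTransition.zero_of_nonpos (by linarith), zero_mul]
  · have hT := frameMap_surjective (hg q.1 q.2 h0)
    have h1 : SmoothAtRegularPoint (fun q' : RegularPoint n M A => ψ (frameMap g q'.1)) q := by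
      have h2 := SmoothAtRegularPoint.comp_contDiffAt (q := q)
        (F := fun (p : Fin (Module.finrank ℝ A) × Fin L) => realComponent (g p.2)
          (LinearMap.proj p.1 ∘ₗ (weilCoord A).toLinearMap))
        (fun p => realComponent_smooth _ _ q)
        (h := fun y => ψ (matrixMap (Module.finrank ℝ A) L y)) ?_
      · simpa only [matrixMap_realComponent] using h2
      · have hc : ContinuousAt (matrixMap (Module.finrank ℝ A) L) fun p => realComponent (g p.2)
          (LinearMap.proj p.1 ∘ₗ (weilCoord A).toLinearMap) q :=
          (matrixMap (Module.finrank ℝ A) L).continuous.continuousAt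
        filter_upwards [hc.eventually (by
          rw [matrixMap_realComponent]
          exact ContinuousLinearMap.eventually_surjective hT)] with y hy
        exact (hψ _ hy).comp y (matrixMap (Module.finrank ℝ A) L).contDiff.contDiffAt
    have h3 : SmoothAtRegularPoint (fun q' : RegularPoint n M A =>
        Real.smoothTransition (4 * weilAugmentation A (q'.1 ρ) - 2)) q :=
      SmoothAtRegularPoint.comp_contDiff (ι := Unit)
        (F := fun _ => realComponent ρ (weilAugmentation A).toLinearMap) (fun _ => haug q)
        (h := fun y => Real.smoothTransition (4 * y () - 2))
        (Real.smoothTransition.contDiff.comp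
          ((contDiff_const.mul (contDiff_apply ℝ ℝ ())).sub contDiff_const))
    exact h3.comp₂ h1 (b := fun p => p.1 * p.2) (contDiff_fst.mul contDiff_snd)

variable [IsManifold (𝓡 n) ∞ M] [T2Space M] [SecondCountableTopology M]

/-- Near the orbit of a regular point `q₀` there is a smooth choice of automorphisms which carry the
points of an orbit to one and the same point. Cut off by the invariant function `P`, it is given by
endomorphisms `θ q` defined for all regular points. -/
theorem exists_orbit_normalization (q₀ : RegularPoint n M A) :
    ∃ (P : RegularPoint n M A → ℝ) (θ : RegularPoint n M A → A →ₗ[ℝ] A),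
      P ∈ smoothOnRegularPoints n M A ∧
      (∀ (w : Module.Dual ℝ A) b, (fun q => w (θ q b)) ∈ smoothOnRegularPoints n M A) ∧
      (∀ (τ : A ≃ₐ[ℝ] A) q, P (q.map τ) = P q ∧ ∀ b, θ (q.map τ) (τ b) = θ q b) ∧
      (∀ q, P q ≠ 0 → ∃ τ : A ≃ₐ[ℝ] A, ∀ b, θ q b = P q • τ b) ∧
      (∀ᶠ q in 𝓝 q₀, P q = 1) ∧ θ q₀ = LinearMap.id := by
  obtain ⟨x, hx⟩ := exists_isBasePoint q₀.1
  obtain ⟨L, g, ρ, hρ, hg⟩ := exists_spanning_functions (n := n) A x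
  have haug₀ : weilAugmentation A (q₀.1 ρ) = 1 := (hx ρ).trans hρ
  have hT₀ := frameMap_surjective (hg q₀.1 q₀.2 (by rw [haug₀]; exact one_ne_zero))
  obtain ⟨β, θ, hsmooth, hinv, haut, hone, hθ₀⟩ := exists_slice (weilProduct A) _ hT₀
  let C : RegularPoint n M A → ℝ := fun q =>
    Real.smoothTransition (4 * weilAugmentation A (q.1 ρ) - 2)
  have hC0 : ∀ q, C q ≠ 0 → Function.Surjective (frameMap g q.1) := fun q hq =>
    frameMap_surjective (hg q.1 q.2 fun h => hq
      (Real.smoothTransition.zero_of_nonpos (by rw [h]; norm_num)))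
  let e := weilCoord A
  let Θ : RegularPoint n M A → A →ₗ[ℝ] A := fun q =>
    C q • (e.symm.toLinearMap ∘ₗ (θ (frameMap g q.1)).toLinearMap ∘ₗ e.toLinearMap)
  have hΘ : ∀ q b, Θ q b = C q • e.symm (θ (frameMap g q.1) (e b)) := fun _ _ => rfl
  have hmap : ∀ (τ : A ≃ₐ[ℝ] A) (q : RegularPoint n M A), frameMap g (q.map τ).1 =
      (LinearMap.toContinuousLinearMap (e.toLinearMap ∘ₗ τ.toLinearMap ∘ₗ e.symm.toLinearMap)).comp
        (frameMap g q.1) := by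
    intro τ q
    ext1 y
    change e (∑ j, y j • τ (q.1 (g j))) = e (τ (e.symm (e (∑ j, y j • q.1 (g j)))))
    simp
  have hCmap : ∀ (τ : A ≃ₐ[ℝ] A) (q : RegularPoint n M A), C (q.map τ) = C q := by
    intro τ q
    simp only [C, RegularPoint.map_apply, weilAugmentation_algEquiv]
  refine ⟨fun q => C q * β (frameMap g q.1), Θ, frameMap_smooth hg fun T hT => (hsmooth T hT).1,
    fun w b => ?_, fun τ q => ?_, fun q hq => ?_, ?_, ?_⟩
  · have h1 : (fun q => w (Θ q b)) = fun q : RegularPoint n M A =>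
        Real.smoothTransition (4 * weilAugmentation A (q.1 ρ) - 2) *
          (w ∘ₗ e.symm.toLinearMap) (θ (frameMap g q.1) (e b)) := by
      funext q
      rw [hΘ, map_smul, smul_eq_mul]
      rfl
    rw [h1]
    refine frameMap_smooth hg (ψ := fun T => (w ∘ₗ e.symm.toLinearMap) (θ T (e b))) fun T hT => ?_
    exact (LinearMap.toContinuousLinearMap (w ∘ₗ e.symm.toLinearMap)).contDiff.contDiffAt.comp T
      ((hsmooth T hT).2.clm_apply contDiffAt_const)
  · by_cases hq : C q = 0
    · have hq' : C (q.map τ) = 0 := by rw [hCmap, hq]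
      simp only [hq, hq', hΘ, zero_mul, zero_smul, implies_true, and_self]
    · have h1 := hinv _ _ (isBilinAut_weilProduct_algEquiv τ) (hC0 q hq)
      simp only [hCmap, hΘ, hmap]
      refine ⟨congrArg (C q * ·) h1.1, fun b => ?_⟩
      rw [← h1.2]
      congr 2
      change _ = θ _ (e (τ (e.symm (e b))))
      rw [e.symm_apply_apply]
  · obtain ⟨h, hh, hθ⟩ := haut _ (hC0 q (left_ne_zero_of_mul hq)) (right_ne_zero_of_mul hq)
    obtain ⟨τ, hτ⟩ := hh.exists_algEquiv
    refine ⟨τ, fun b => ?_⟩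
    rw [hΘ, hθ, mul_smul, ← e.symm_apply_apply (τ b), hτ]
    simp
    rfl
  · have h1 : ∀ᶠ q in 𝓝 q₀, β (frameMap g q.1) = 1 := by
      have hc : Continuous fun q : RegularPoint n M A => frameMap g q.1 := by
        simp only [← matrixMap_realComponent]
        exact (matrixMap (Module.finrank ℝ A) L).continuous.comp
          (continuous_pi fun p => continuous_realComponent _ _)
      exact hc.continuousAt.eventually hone
    have h2 := (continuousAt_const (y := (3 / 4 : ℝ)) (x := q₀)).eventually_lt
      ((continuous_realComponent ρ (weilAugmentation A).toLinearMap).continuousAt (x := q₀))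
      (by change _ < weilAugmentation A (q₀.1 ρ); rw [haug₀]; norm_num)
    filter_upwards [h1, h2] with q hq1 hq2
    have hq3 : (3 / 4 : ℝ) < weilAugmentation A (q.1 ρ) := hq2
    rw [hq1, mul_one]
    exact Real.smoothTransition.one_of_one_le (by linarith)
  · ext b
    have hC₀ : C q₀ = 1 := Real.smoothTransition.one_of_one_le (by rw [haug₀]; norm_num)
    rw [hΘ, hθ₀, hC₀, one_smul]
    simp

end Normalization

/-! ### Smooth functions of jets near a given jet -/

section Jets

variable {n : ℕ} {M : Type*} [TopologicalSpace M] [ChartedSpace (EuclideanSpace ℝ (Fin n)) M]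
  {A : Type*} [CommRing A] [Algebra ℝ A]

/-- A smooth choice, near the orbit of the regular point `q₀`, of automorphisms of `A` which carry
the points of an orbit to one and the same point. It is multiplied by an invariant cutoff function,
and so consists of endomorphisms `toEnd q` defined for all regular points `q`. -/
structure OrbitNormalization (q₀ : RegularPoint n M A) where
  /-- The invariant cutoff function. -/
  cutoff : smoothOnJets n M A
  /-- The multiple by the cutoff function of the automorphism which normalizes `q`. -/
  toEnd : RegularPoint n M A → A →ₗ[ℝ] A
  smooth_toEnd : ∀ (w : Module.Dual ℝ A) b, (fun q => w (toEnd q b)) ∈ smoothOnRegularPoints n M A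
  toEnd_map : ∀ (τ : A ≃ₐ[ℝ] A) q b, toEnd (q.map τ) (τ b) = toEnd q b
  exists_algEquiv : ∀ q : RegularPoint n M A, cutoff.1 q.jet ≠ 0 →
    ∃ τ : A ≃ₐ[ℝ] A, ∀ b, toEnd q b = cutoff.1 q.jet • τ b
  cutoff_eventually : ∀ᶠ q : RegularPoint n M A in 𝓝 q₀, cutoff.1 q.jet = 1
  toEnd_self : toEnd q₀ = LinearMap.id

theorem nonempty_orbitNormalization [IsWeilAlgebra A] [IsManifold (𝓡 n) ∞ M] [T2Space M]
    [SecondCountableTopology M] (q₀ : RegularPoint n M A) : Nonempty (OrbitNormalization q₀) := by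
  obtain ⟨P, θ, hP, hθ, hinv, haut, hone, hid⟩ := exists_orbit_normalization q₀
  obtain ⟨F, hF⟩ := exists_smoothOnJets hP fun τ q => (hinv τ q).1
  exact ⟨⟨F, θ, hθ, fun τ q => (hinv τ q).2, by simpa only [hF], by simpa only [hF], hid⟩⟩

theorem Subalgebra.sum_apply {X ι : Type*} [Fintype ι] {S : Subalgebra ℝ (X → ℝ)} (F : ι → S)
    (x : X) : (∑ i, F i).1 x = ∑ i, (F i).1 x :=
  map_sum ((Pi.evalAlgHom ℝ (fun _ : X => ℝ) x).comp S.val) F _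

theorem smoothOnJets_ext {F G : smoothOnJets n M A}
    (h : ∀ q : RegularPoint n M A, F.1 q.jet = G.1 q.jet) : F = G := by
  refine Subtype.ext (funext fun 𝔭 => ?_)
  obtain ⟨q, rfl⟩ := RegularPoint.exists_jet_eq 𝔭
  exact h q

variable [Module.Finite ℝ A]

theorem sum_coord_mul_apply (w : Module.Dual ℝ A) (l : A →ₗ[ℝ] A) (a : A) :
    ∑ i, w (l (Module.finBasis ℝ A i)) * (Module.finBasis ℝ A).coord i a = w (l a) := by
  conv_rhs => rw [← (Module.finBasis ℝ A).sum_repr a, map_sum, map_sum]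
  refine Finset.sum_congr rfl fun i _ => ?_
  rw [map_smul, map_smul, smul_eq_mul, mul_comm, Module.Basis.coord_apply]

namespace OrbitNormalization

variable {q₀ : RegularPoint n M A} (N : OrbitNormalization q₀)

theorem exists_component (f : SmoothRing n M) (w : Module.Dual ℝ A) :
    ∃ F : smoothOnJets n M A, ∀ q : RegularPoint n M A, F.1 q.jet = w (N.toEnd q (q.1 f)) := by
  refine exists_smoothOnJets ?_ fun τ q => by rw [RegularPoint.map_apply, N.toEnd_map]
  have h : (fun q : RegularPoint n M A => w (N.toEnd q (q.1 f))) =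
      ∑ i, (fun q => w (N.toEnd q (Module.finBasis ℝ A i))) *
        realComponent f ((Module.finBasis ℝ A).coord i) := by
    funext q
    rw [← sum_coord_mul_apply w, Finset.sum_apply]
    rfl
  rw [h]
  exact sum_mem fun i _ => mul_mem (N.smooth_toEnd w _) (realComponent_smooth f _)

/-- The component along `w` of the value at `f` of the normalized regular point: it only depends on
the jet. These functions are local generators of the smooth functions of jets. -/
def component : SmoothRing n M →ₗ[ℝ] Module.Dual ℝ A →ₗ[ℝ] smoothOnJets n M A :=
  have h := fun f w => (N.exists_component f w).choose_spec
  LinearMap.mk₂ ℝ (fun f w => (N.exists_component f w).choose)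
    (fun f f' w => smoothOnJets_ext fun q => by
      refine (h _ _ q).trans (Eq.trans ?_ (congrArg₂ (· + ·) (h f w q) (h f' w q)).symm)
      simp only [map_add])
    (fun c f w => smoothOnJets_ext fun q => by
      refine (h _ _ q).trans (Eq.trans ?_ (congrArg (c * ·) (h f w q)).symm)
      simp only [map_smul, smul_eq_mul])
    (fun f w w' => smoothOnJets_ext fun q =>
      (h _ _ q).trans (congrArg₂ (· + ·) (h f w q) (h f w' q)).symm)
    (fun c f w => smoothOnJets_ext fun q => (h _ _ q).trans (congrArg (c * ·) (h f w q)).symm)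

theorem component_apply (f : SmoothRing n M) (w : Module.Dual ℝ A) (q : RegularPoint n M A) :
    (N.component f w).1 q.jet = w (N.toEnd q (q.1 f)) :=
  (N.exists_component f w).choose_spec q

theorem component_apply_self (f : SmoothRing n M) (w : Module.Dual ℝ A) :
    (N.component f w).1 q₀.jet = w (q₀.1 f) := by
  rw [N.component_apply, N.toEnd_self, LinearMap.id_apply]

/-- Tangent vectors at a jet only depend on germs. Functions supported near the jet of `q₀` arise by
composing a bump function with the cutoff function and finitely many components: where the cutoff
function does not vanish, the quotients of the components by it are real components of a regular
point over the same jet. -/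
theorem apply_eq_of_eventuallyEq (N : OrbitNormalization q₀)
    (u : tangentSpaceAt (smoothOnJets n M A) q₀.jet)
    {F G : smoothOnJets n M A}
    (h : ∀ᶠ q : RegularPoint n M A in 𝓝 q₀, F.1 q.jet = G.1 q.jet) : u.1 F = u.1 G := by
  obtain ⟨k, f, w, O, hO, hqO, hON⟩ := exists_realComponent_nhds h
  let c : Fin k → ℝ := fun i => realComponent (f i) (w i) q₀
  let y₀ : Fin (k + 1) → ℝ := Fin.cons 1 c
  let Q : (Fin (k + 1) → ℝ) → Fin k → ℝ := fun y i => y i.succ / y 0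
  have hQ : ContinuousAt Q y₀ := continuousAt_pi.2 fun i =>
    (continuous_apply _).continuousAt.div (continuous_apply _).continuousAt (by simp [y₀])
  have hQ₀ : Q y₀ = c := funext fun i => by simp [Q, y₀]
  have hnhds : ∀ᶠ y in 𝓝 y₀, y 0 ≠ 0 ∧ Q y ∈ O :=
    ((continuous_apply 0).continuousAt.eventually_ne (by simp [y₀])).and
      (hQ.eventually_mem (by rw [hQ₀]; exact hO.mem_nhds hqO))
  obtain ⟨χ, hχ, -, hχs, -, hχ1⟩ := exists_contDiff_tsupport_subset (n := ⊤) hnhds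
  let S : Fin (k + 1) → smoothOnJets n M A := Fin.cons N.cutoff fun i => N.component (f i) (w i)
  have hS : (fun i => (S i).1 q₀.jet) = y₀ := by
    ext i
    refine Fin.cases ?_ (fun i => ?_) i
    · exact N.cutoff_eventually.self_of_nhds
    · exact N.component_apply_self _ _
  refine tangentSpaceAt.apply_eq_of_mul_eq u
    (b := ⟨_, smoothlyClosed_smoothOnJets (k + 1) S χ hχs⟩) ((congrArg χ hS).trans hχ1) ?_
    h.self_of_nhds
  intro 𝔭 h𝔭
  obtain ⟨q, rfl⟩ := RegularPoint.exists_jet_eq 𝔭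
  obtain ⟨h1, h2⟩ := hχ (subset_tsupport _ h𝔭)
  have h1' : N.cutoff.1 q.jet ≠ 0 := h1
  obtain ⟨τ, hτ⟩ := N.exists_algEquiv q h1'
  rw [← q.jet_map τ]
  refine hON (q.map τ) ?_
  convert h2 using 1
  ext i
  change w i (τ (q.1 (f i))) = (N.component (f i) (w i)).1 q.jet / N.cutoff.1 q.jet
  rw [N.component_apply, hτ, map_smul, smul_eq_mul, mul_div_cancel_left₀ _ h1']

/-- The derivation `C^∞(M) → A` given by a tangent vector at the jet of `q₀`. -/
def der : tangentSpaceAt (smoothOnJets n M A) q₀.jet →ₗ[ℝ] SmoothRing n M →ₗ[ℝ] A :=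
  LinearMap.mk₂ ℝ (fun u f => (Module.evalEquiv ℝ A).symm (u.1 ∘ₗ N.component f))
    (fun u u' f => by rw [← map_add]; rfl)
    (fun c u f => by rw [← map_smul]; rfl)
    (fun u f f' => by rw [← map_add, map_add, LinearMap.comp_add])
    (fun c u f => by rw [← map_smul, map_smul, LinearMap.comp_smul])

theorem apply_der (u : tangentSpaceAt (smoothOnJets n M A) q₀.jet) (f : SmoothRing n M)
    (w : Module.Dual ℝ A) : w (N.der u f) = u.1 (N.component f w) :=
  Module.apply_evalEquiv_symm_apply ℝ A w (u.1 ∘ₗ N.component f)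

theorem der_mul (u : tangentSpaceAt (smoothOnJets n M A) q₀.jet) (f g : SmoothRing n M) :
    N.der u (f * g) = q₀.1 f * N.der u g + q₀.1 g * N.der u f := by
  rw [← sub_eq_zero, ← Module.forall_dual_apply_eq_zero_iff ℝ]
  intro w
  rw [map_sub, sub_eq_zero, N.apply_der]
  let b := Module.finBasis ℝ A
  have h1 : u.1 (N.component (f * g) w) = u.1 (∑ i, N.component f (b.coord i) *
      N.component g (w ∘ₗ LinearMap.mulRight ℝ (b i))) := by
    refine N.apply_eq_of_eventuallyEq u ?_
    filter_upwards [N.cutoff_eventually] with q hq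
    obtain ⟨τ, hτ⟩ := N.exists_algEquiv q (by rw [hq]; exact one_ne_zero)
    rw [Subalgebra.sum_apply]
    change _ = ∑ i, (N.component f (b.coord i)).1 q.jet *
      (N.component g (w ∘ₗ LinearMap.mulRight ℝ (b i))).1 q.jet
    simp only [N.component_apply, hτ, hq, one_smul, map_mul]
    rw [← LinearMap.mulLeft_apply (R := ℝ) (τ (q.1 f)), LinearMap.mulLeft_apply, mul_comm,
      ← LinearMap.mulLeft_apply (R := ℝ), ← sum_coord_mul_apply w]
    exact Finset.sum_congr rfl fun i _ => mul_comm _ _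
  rw [h1, map_sum]
  simp only [u.2 _ _, N.component_apply_self, ← N.apply_der]
  rw [Finset.sum_add_distrib, map_add, mul_comm (q₀.1 f), ← LinearMap.mulLeft_apply (R := ℝ),
    ← LinearMap.mulLeft_apply (R := ℝ) (q₀.1 g), ← sum_coord_mul_apply w,
    ← sum_coord_mul_apply w]
  congr 1
  exact Finset.sum_congr rfl fun i _ => mul_comm _ _

/-- A tangent vector at `q₀` with the derivation of a tangent vector `u` at its jet projects to
`u`. -/
theorem kerTangentMap_eq (u : tangentSpaceAt (smoothOnJets n M A) q₀.jet)
    (v : tangentSpaceAt (smoothOnRegularPoints n M A) q₀)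
    (hv : ∀ f w, v.1 ⟨realComponent f w, realComponent_smooth f w⟩ = w (N.der u f)) :
    kerTangentMap q₀ q₀.jet rfl v = u := by
  refine Subtype.ext (LinearMap.ext fun F => ?_)
  change v.1 (kerPullback F) = u.1 F
  obtain ⟨k, f, w, h, hh, hF⟩ := (kerPullback F).2 q₀
  have h1 : u.1 F = u.1 ⟨_, smoothlyClosed_smoothOnJets k
      (fun i => N.component (f i) (w i)) h hh⟩ := by
    refine N.apply_eq_of_eventuallyEq u ?_
    obtain ⟨l, g, z, O, hO, hqO, hON⟩ := exists_realComponent_nhds hF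
    have hc : ContinuousAt (fun (q : RegularPoint n M A) i => (N.component (g i) (z i)).1 q.jet)
        q₀ :=
      continuousAt_pi.2 fun i =>
        SmoothAtRegularPoint.continuousAt ((kerPullback (N.component (g i) (z i))).2 q₀)
    have hmem := hc.eventually_mem (s := O) (by
      simp only [N.component_apply_self]
      exact hO.mem_nhds hqO)
    filter_upwards [N.cutoff_eventually, hmem] with q hq hqO'
    obtain ⟨τ, hτ⟩ := N.exists_algEquiv q (by rw [hq]; exact one_ne_zero)
    have h2 : ∀ f' w', (N.component f' w').1 q.jet = realComponent f' w' (q.map τ) := by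
      intro f' w'
      rw [N.component_apply, hτ, hq, one_smul]
      rfl
    simp only [h2] at hqO'
    have h3 : (kerPullback F).1 (q.map τ) = _ := hON _ hqO'
    change F.1 (q.map τ).jet = _ at h3
    rw [q.jet_map τ] at h3
    simp only [h2, h3]
  rw [h1, tangentSpaceAt.chain_rule smoothlyClosed_smoothOnJets u _ hh,
    tangentSpaceAt.chain_rule_realComponent v hh hF]
  simp only [N.component_apply_self, hv, N.apply_der]
  rfl

end OrbitNormalization

end Jets

/-! ### Tangent vectors at a jet as classes of derivations -/

section Tangent

variable {n : ℕ} {M : Type*} [TopologicalSpace M] [ChartedSpace (EuclideanSpace ℝ (Fin n)) M]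
  {A : Type*} [CommRing A] [Algebra ℝ A]

/-- A derivation descends to the quotient by `𝔭` if and only if it vanishes on `𝔭`. -/
theorem mem_range_compAlgebraMapL {𝔭 : Ideal (SmoothRing n M)}
    {D : Derivation ℝ (SmoothRing n M) (SmoothRing n M ⧸ 𝔭)} :
    D ∈ LinearMap.range (Derivation.compAlgebraMapL ℝ (SmoothRing n M) (SmoothRing n M ⧸ 𝔭)
      (SmoothRing n M ⧸ 𝔭)) ↔ ∀ f ∈ 𝔭, D f = 0 := by
  constructor
  · rintro ⟨D', rfl⟩ f hf
    change D' (Ideal.Quotient.mk 𝔭 f) = 0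
    rw [Ideal.Quotient.eq_zero_iff_mem.2 hf, map_zero]
  · intro h
    have hs := Ideal.Quotient.mk_surjective (I := 𝔭)
    let s := Function.surjInv hs
    have hms : ∀ x, Ideal.Quotient.mk 𝔭 (s x) = x := Function.surjInv_eq hs
    have hD : ∀ f g, Ideal.Quotient.mk 𝔭 f = Ideal.Quotient.mk 𝔭 g → D f = D g := fun f g hfg => by
      rw [← sub_eq_zero, ← map_sub]
      exact h _ (Ideal.Quotient.eq.1 hfg)
    refine ⟨Derivation.mk' ⟨⟨fun x => D (s x), fun x y => ?_⟩, fun c x => ?_⟩ fun x y => ?_, ?_⟩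
    · rw [← map_add]
      exact hD _ _ (by rw [map_add, hms, hms, hms])
    · rw [RingHom.id_apply, ← D.map_smul]
      refine hD _ _ ((hms _).trans ?_)
      exact congrArg (c • ·) (hms x).symm
    · change D (s (x * y)) = x * D (s y) + y * D (s x)
      rw [hD _ (s x * s y) (by rw [map_mul, hms, hms, hms]), D.leibniz]
      change Ideal.Quotient.mk 𝔭 (s x) * _ + Ideal.Quotient.mk 𝔭 (s y) * _ = _
      rw [hms, hms]
    · ext1 f
      exact hD _ _ (hms _)

/-- The isomorphism `C^∞(M)/𝔭 → A` induced by a regular point `q` with `Ker q = 𝔭`. -/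
def RegularPoint.quotientEquiv (q : RegularPoint n M A) : (SmoothRing n M ⧸ q.jet.1) ≃ₐ[ℝ] A :=
  Ideal.quotientKerAlgEquivOfSurjective q.2

theorem RegularPoint.quotientEquiv_apply (q : RegularPoint n M A) (x : SmoothRing n M ⧸ q.jet.1) :
    q.quotientMap q.jet rfl x = q.quotientEquiv x := by
  obtain ⟨f, rfl⟩ := Ideal.Quotient.mk_surjective x
  rfl

theorem RegularPoint.quotientEquiv_smul (q : RegularPoint n M A) (f : SmoothRing n M)
    (x : SmoothRing n M ⧸ q.jet.1) : q.quotientEquiv (f • x) = q.1 f * q.quotientEquiv x :=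
  map_mul q.quotientEquiv (Ideal.Quotient.mk q.jet.1 f) x

theorem RegularPoint.quotientMap_map (q : RegularPoint n M A) (τ : A ≃ₐ[ℝ] A) {𝔭 : JetOfType n M A}
    (hq : q.jet = 𝔭) (hq' : (q.map τ).jet = 𝔭) (x : SmoothRing n M ⧸ 𝔭.1) :
    (q.map τ).quotientMap 𝔭 hq' x = τ (q.quotientMap 𝔭 hq x) := by
  obtain ⟨f, rfl⟩ := Ideal.Quotient.mk_surjective x
  rfl

namespace OrbitNormalization

variable [Module.Finite ℝ A] {q₀ : RegularPoint n M A} (N : OrbitNormalization q₀)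

/-- On the ideal of the jet, the derivation of the projection of a tangent vector is that of the
tangent vector: there the contribution of the derivative of `toEnd` vanishes. -/
theorem der_kerTangentMap {q : RegularPoint n M A} (hq : q.jet = q₀.jet)
    {v : tangentSpaceAt (smoothOnRegularPoints n M A) q}
    {D : Derivation ℝ (SmoothRing n M) (SmoothRing n M ⧸ q₀.jet.1)}
    (hv : Corresponds q q₀.jet hq v D) {f : SmoothRing n M} (hf : f ∈ q₀.jet.1) :
    N.der (kerTangentMap q q₀.jet hq v) f = q₀.quotientEquiv (D f) := by
  rw [← sub_eq_zero, ← Module.forall_dual_apply_eq_zero_iff ℝ]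
  intro w
  rw [map_sub, sub_eq_zero, N.apply_der]
  change v.1 (kerPullback (N.component f w)) = _
  let b := Module.finBasis ℝ A
  have h1 : kerPullback (N.component f w) = ∑ i, (⟨_, N.smooth_toEnd w (b i)⟩ *
      ⟨realComponent f (b.coord i), realComponent_smooth f (b.coord i)⟩ :
        smoothOnRegularPoints n M A) := by
    ext q'
    refine ((N.component_apply f w q').trans ?_).trans (Subalgebra.sum_apply _ q').symm
    exact (sum_coord_mul_apply w _ _).symm
  have hqf : q.1 f = 0 := by
    rw [← hq] at hf
    exact hf
  have h2 : ∀ w', realComponent f w' q = 0 := fun w' => by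
    rw [realComponent, hqf, map_zero]
  rw [h1, map_sum]
  simp only [v.2 _ _, h2, zero_mul, add_zero, hv f]
  rw [sum_coord_mul_apply w]
  obtain ⟨τ, rfl⟩ := RegularPoint.exists_map_eq_of_jet_eq hq
  rw [q₀.quotientMap_map τ rfl, N.toEnd_map, N.toEnd_self, q₀.quotientEquiv_apply]
  rfl

/-- The derivation `C^∞(M) → C^∞(M)/𝔭` given by a tangent vector at the jet `𝔭` of `q₀`. -/
def derivation : tangentSpaceAt (smoothOnJets n M A) q₀.jet →ₗ[ℝ]
    Derivation ℝ (SmoothRing n M) (SmoothRing n M ⧸ q₀.jet.1) where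
  toFun u := Derivation.mk' (q₀.quotientEquiv.symm.toLinearMap ∘ₗ N.der u) fun f g => by
    apply q₀.quotientEquiv.injective
    rw [map_add, q₀.quotientEquiv_smul, q₀.quotientEquiv_smul]
    simp [N.der_mul]
  map_add' u u' := by
    ext1 f
    simp
  map_smul' c u := by
    ext1 f
    simp

theorem quotientEquiv_derivation (u : tangentSpaceAt (smoothOnJets n M A) q₀.jet)
    (f : SmoothRing n M) : q₀.quotientEquiv (N.derivation u f) = N.der u f :=
  q₀.quotientEquiv.apply_symm_apply _

/-- The class in the tangent module of the derivation of a tangent vector at a jet. -/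
def toTangentModule : tangentSpaceAt (smoothOnJets n M A) q₀.jet →ₗ[ℝ] TangentModule q₀.jet.1 where
  toFun u := Submodule.Quotient.mk (N.derivation u)
  map_add' u u' := by rw [map_add, Submodule.Quotient.mk_add]
  map_smul' c u := by rw [map_smul, Submodule.Quotient.mk_smul, RingHom.id_apply]

/-- The characteristic property, at all regular points over the jet of `q₀`. -/
theorem toTangentModule_kerTangentMap {q : RegularPoint n M A} (hq : q.jet = q₀.jet)
    {v : tangentSpaceAt (smoothOnRegularPoints n M A) q}
    {D : Derivation ℝ (SmoothRing n M) (SmoothRing n M ⧸ q₀.jet.1)}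
    (hv : Corresponds q q₀.jet hq v D) :
    N.toTangentModule (kerTangentMap q q₀.jet hq v) = Submodule.Quotient.mk D := by
  refine (Submodule.Quotient.eq _).2 (mem_range_compAlgebraMapL.2 fun f hf => ?_)
  apply q₀.quotientEquiv.injective
  rw [Derivation.sub_apply, map_sub, N.quotientEquiv_derivation, N.der_kerTangentMap hq hv hf,
    sub_self, map_zero]

end OrbitNormalization

variable [IsWeilAlgebra A] [IsManifold (𝓡 n) ∞ M] [T2Space M] [SecondCountableTopology M]

namespace OrbitNormalization

variable {q₀ : RegularPoint n M A} (N : OrbitNormalization q₀)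

/-- Every tangent vector at the jet of `q₀` is the projection of a tangent vector at `q₀` which
corresponds to its derivation. -/
theorem exists_corresponds_derivation (u : tangentSpaceAt (smoothOnJets n M A) q₀.jet) :
    ∃ v, Corresponds q₀ q₀.jet rfl v (N.derivation u) ∧ kerTangentMap q₀ q₀.jet rfl v = u := by
  obtain ⟨v, hv⟩ := exists_tangent_of_derivation q₀ (N.der_mul u)
  refine ⟨v, fun f w => ?_, N.kerTangentMap_eq u v hv⟩
  rw [hv, q₀.quotientEquiv_apply, N.quotientEquiv_derivation]

/-- If the class of the derivation of a tangent vector is zero, the derivation comes from a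
derivation of `A`, and so the tangent vector is the projection of a vertical vector. -/
theorem toTangentModule_injective : Function.Injective N.toTangentModule := by
  intro u₁ u₂ h
  obtain ⟨D, hD⟩ := (Submodule.Quotient.eq _).1 h
  rw [← map_sub] at hD
  rw [← sub_eq_zero]
  generalize u₁ - u₂ = u at hD
  obtain ⟨v, hv, hvu⟩ := N.exists_corresponds_derivation u
  let e := q₀.quotientEquiv
  have hF : ∀ F, v.1 (kerPullback F) = 0 := fun F => by
    refine tangentSpaceAt.apply_eq_zero_of_vertical v
      (δ := e.toLinearMap ∘ₗ (D : _ →ₗ[ℝ] _) ∘ₗ e.symm.toLinearMap) (fun a b => ?_)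
      (fun f w => ?_) (kerPullback F) fun τ q => congrArg F.1 (q.jet_map τ)
    · simp
    · rw [hv, q₀.quotientEquiv_apply, ← hD]
      have h1 : e.symm (q₀.1 f) = Ideal.Quotient.mk q₀.jet.1 f := e.symm_apply_eq.2 rfl
      change w (e (D (Ideal.Quotient.mk q₀.jet.1 f))) = w (e (D (e.symm (q₀.1 f))))
      rw [h1]
  rw [← hvu]
  exact Subtype.ext (LinearMap.ext hF)

theorem toTangentModule_surjective : Function.Surjective N.toTangentModule := by
  intro x
  obtain ⟨D, rfl⟩ := Submodule.Quotient.mk_surjective _ x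
  obtain ⟨v, hv⟩ := exists_tangent_of_derivation q₀
    (d := q₀.quotientEquiv.toLinearMap ∘ₗ (D : _ →ₗ[ℝ] _)) fun f g => by
      change q₀.quotientEquiv (D (f * g)) = _
      rw [D.leibniz, map_add, q₀.quotientEquiv_smul, q₀.quotientEquiv_smul]
      rfl
  refine ⟨_, N.toTangentModule_kerTangentMap rfl (v := v) fun f w => ?_⟩
  rw [hv, q₀.quotientEquiv_apply]
  rfl

end OrbitNormalization

end Tangent

end

theorem mainTheorem4 (n : ℕ) (M : Type*) [TopologicalSpace M]
    [ChartedSpace (EuclideanSpace ℝ (Fin n)) M] [IsManifold (𝓡 n) ∞ M]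
    [T2Space M] [SecondCountableTopology M]
    (A : Type*) [CommRing A] [Algebra ℝ A] [IsWeilAlgebra A] (𝔭 : JetOfType n M A) :
    ∃! Φ : tangentSpaceAt (smoothOnJets n M A) 𝔭 ≃ₗ[ℝ] TangentModule 𝔭.1,
      ∀ (q : RegularPoint n M A) (hq : q.jet = 𝔭)
        (v : tangentSpaceAt (smoothOnRegularPoints n M A) q)
        (D : Derivation ℝ (SmoothRing n M) (SmoothRing n M ⧸ 𝔭.1)),
        Corresponds q 𝔭 hq v D →
          Φ (kerTangentMap q 𝔭 hq v) = Submodule.Quotient.mk D := by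
  obtain ⟨q₀, rfl⟩ := RegularPoint.exists_jet_eq 𝔭
  obtain ⟨N⟩ := nonempty_orbitNormalization q₀
  refine ⟨LinearEquiv.ofBijective N.toTangentModule
    ⟨N.toTangentModule_injective, N.toTangentModule_surjective⟩,
    fun q hq v D h => N.toTangentModule_kerTangentMap hq h, fun Φ hΦ => LinearEquiv.ext fun u => ?_⟩
  obtain ⟨v, hv, hvu⟩ := N.exists_corresponds_derivation u
  conv_lhs => rw [← hvu]
  exact hΦ q₀ rfl v _ hv
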